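/- For a space $X$ with basepoint $x_0$, let $\Omega(X,x_0)$ be the space of loops at $x_0$ with the compact-open topology and let $\pi_1^{qtop}(X,x_0)$ be the fundamental group $\pi_1(X,x_0)$ with the quotient topology from $\Omega(X,x_0)$. For a group $G$ with a topology (the operations need not be continuous), let $\tau(G)$ be the group $G$ with the quotient topology along the multiplication epimorphism $F_M(G)\to G$ extending the identity of $G$, where $F_M(Y)$ denotes the free (Markov) topological group on a space $Y$. Then $\tau(G)$ is a topological group; put $\pi_1^{\tau}(X,x_0)=\tau(\pi_1^{qtop}(X,x_0))$. It is a functor from based spaces to topological groups (no separation axiom is assumed). Let $I=[0,1]$. A path $p:I\to Y$ is well-ended if for every open neighborhood $\mathcal U$ of $p$ in the space $P(Y)$ of all paths $I\to Y$ (compact-open topology) there are open neighborhoods $V_0,V_1$ of $p(0),p(1)$ in $Y$ such that for all $a\in V_0$, $b\in V_1$ there is $q\in\mathcal U$ with $q(0)=a$ and $q(1)=b$. The space $Y$ is wep-connected if any two points $x,y\in Y$ are joined by a well-ended path from $x$ to $y$. Theorem (topological van Kampen theorem). Let $(X,x_0)$ be a based space and let $U_1,U_2\subseteq X$ be open sets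 with $U_1\cup U_2=X$ and $x_0\in U_1\cap U_2$ such that $U_1$, $U_2$ and $U_1\cap U_2$ are path connected. Let $k_i:U_1\cap U_2\hookrightarrow U_i$ and $l_i:U_i\hookrightarrow X$ be the inclusions. If $U_1\cap U_2$ is wep-connected, then the square of continuous homomorphisms $$\begin{array}{ccc} \pi_1^{\tau}(U_1\cap U_2,x_0) & \xrightarrow{(k_1)_*} & \pi_1^{\tau}(U_1,x_0)\\ {\scriptstyle (k_2)_*}\downarrow & & \downarrow{\scriptstyle (l_1)_*}\\ \pi_1^{\tau}(U_2,x_0) & \xrightarrow{(l_2)_*} & \pi_1^{\tau}(X,x_0)\end{array}$$ is a pushout square in the category of topological groups and continuous homomorphisms. In other words, there is a canonical isomorphism of topological groups $$\pi_1^{\tau}(U_1,x_0)\ast_{\pi_1^{\tau}(U_1\cap U_2,x_0)}\pi_1^{\tau}(U_2,x_0)\;\cong\;\pi_1^{\tau}(X,x_0)$$ which restricts to $(l_i)_*$ on $\pi_1^{\tau}(U_i,x_0)$ for $i=1,2$. Here the free topological product $G_1\ast G_2$ is the free product of groups with the quotient topology from $F_M(G_1\sqcup G_2)$, and $G_1\ast_G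 G_2$ is the corresponding quotient group of $G_1\ast G_2$ with the quotient topology. -/

import Mathlib

open CategoryTheory Topology
open scoped unitInterval

universe u v w

/-! ### The free (Markov) topological group -/

/-- The free topological group `F_M(Y)`: the free group on `Y` with the finest group topology for
which the insertion of generators `Y → F(Y)` is continuous. -/
def FreeTopGroup (Y : Type u) : Type u := FreeGroup Y

namespace FreeTopGroup

instance (Y : Type u) : Group (FreeTopGroup Y) := inferInstanceAs (Group (FreeGroup Y))

/-- The insertion of generators. -/
def of {Y : Type u} (y : Y) : FreeTopGroup Y := FreeGroup.of y

/-- The homomorphism extending a map on generators. -/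
def lift {Y : Type u} {G : Type v} [Group G] (f : Y → G) : FreeTopGroup Y →* G := FreeGroup.lift f

theorem lift_of {Y : Type u} {G : Type v} [Group G] (f : Y → G) (y : Y) : lift f (of y) = f y :=
  FreeGroup.lift_apply_of

theorem hom_ext {Y : Type u} {G : Type v} [Group G] {f g : FreeTopGroup Y →* G}
    (h : ∀ y, f (of y) = g (of y)) : f = g :=
  FreeGroup.ext_hom _ _ h

instance (Y : Type u) [TopologicalSpace Y] : TopologicalSpace (FreeTopGroup Y) :=
  (GroupTopology.coinduced (of : Y → FreeTopGroup Y)).toTopologicalSpace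

instance (Y : Type u) [TopologicalSpace Y] : IsTopologicalGroup (FreeTopGroup Y) :=
  (GroupTopology.coinduced (of : Y → FreeTopGroup Y)).toIsTopologicalGroup

theorem continuous_of {Y : Type u} [TopologicalSpace Y] :
    Continuous (of : Y → FreeTopGroup Y) :=
  GroupTopology.coinduced_continuous _

/-- The universal property of `F_M(Y)`. -/
theorem continuous_lift {Y : Type u} [TopologicalSpace Y] {G : Type v} [Group G]
    [t : TopologicalSpace G] [IsTopologicalGroup G] {f : Y → G} (hf : Continuous f) :
    Continuous (lift f) := by
  let b : GroupTopology (FreeTopGroup Y) :=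
    { toTopologicalSpace := t.induced (lift f)
      toIsTopologicalGroup := topologicalGroup_induced (lift f) }
  have hb : GroupTopology.coinduced (of : Y → FreeTopGroup Y) ≤ b := by
    refine sInf_le ?_
    show TopologicalSpace.coinduced of _ ≤ t.induced (lift f)
    rw [← continuous_iff_coinduced_le, continuous_induced_rng]
    have : (lift f ∘ of : Y → G) = f := funext (lift_of f)
    rw [this]
    exact hf
  exact continuous_iff_le_induced.2 hb

end FreeTopGroup

/-- If a topological group maps onto a group, the quotient topology is a group topology. -/
theorem isTopologicalGroup_coinduced {H : Type u} {G : Type v} [Group H] [t : TopologicalSpace H]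
    [IsTopologicalGroup H] [Group G] (f : H →* G) (hf : Function.Surjective f) :
    @IsTopologicalGroup G (t.coinduced f) _ := by
  let : TopologicalSpace G := t.coinduced f
  have hq : IsOpenQuotientMap f := by
    refine ⟨hf, continuous_coinduced_rng, ?_⟩
    intro s hs
    rw [isOpen_coinduced]
    have : f ⁻¹' (f '' s) = ⋃ k ∈ f.ker, (fun x => x * k) '' s := by
      ext x
      simp only [Set.mem_preimage, Set.mem_image, Set.mem_iUnion, MonoidHom.mem_ker, exists_prop]
      constructor
      · rintro ⟨y, hy, hxy⟩
        exact ⟨y⁻¹ * x, by simp [hxy], y, hy, by simp⟩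
      · rintro ⟨k, hk, y, hy, rfl⟩
        exact ⟨y, hy, by simp [hk]⟩
    rw [this]
    exact isOpen_biUnion fun k _ => (Homeomorph.mulRight k).isOpenMap s hs
  refine { continuous_mul := ?_, continuous_inv := ?_ }
  · rw [(hq.prodMap hq).isQuotientMap.continuous_iff]
    have : (fun p : G × G => p.1 * p.2) ∘ Prod.map f f = fun p : H × H => f (p.1 * p.2) := by
      ext p; simp
    rw [this]
    exact hq.continuous.comp continuous_mul
  · rw [hq.isQuotientMap.continuous_iff]
    have : (fun a : G => a⁻¹) ∘ f = fun a : H => f a⁻¹ := by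
      ext a; simp
    rw [this]
    exact hq.continuous.comp continuous_inv

/-! ### The reflection `τ` of groups with topology into topological groups -/

/-- `τ(G)` for a group `G` with a topology (no compatibility is assumed): the group `G` with the
quotient topology along the multiplication epimorphism `F_M(G) → G`. -/
def Tau (G : Type u) : Type u := G

namespace Tau

instance (G : Type u) [Group G] : Group (Tau G) := inferInstanceAs (Group G)

/-- The identity homomorphism `r_G : G → τ(G)`. -/
def r (G : Type u) [Group G] : G ≃* Tau G := MulEquiv.refl G

/-- The multiplication epimorphism `m_G : F_M(G) → τ(G)`, extending the identity of `G`. -/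
def m (G : Type u) [Group G] : FreeTopGroup G →* Tau G := FreeTopGroup.lift (r G)

instance (G : Type u) [Group G] [TopologicalSpace G] : TopologicalSpace (Tau G) :=
  TopologicalSpace.coinduced (m G) inferInstance

theorem m_of {G : Type u} [Group G] (g : G) : m G (FreeTopGroup.of g) = r G g :=
  FreeTopGroup.lift_of _ g

theorem m_surjective (G : Type u) [Group G] : Function.Surjective (m G) := fun g =>
  ⟨FreeTopGroup.of ((r G).symm g), by rw [m_of]; simp⟩

instance (G : Type u) [Group G] [TopologicalSpace G] : IsTopologicalGroup (Tau G) :=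
  isTopologicalGroup_coinduced (m G) (m_surjective G)

theorem continuous_r (G : Type u) [Group G] [TopologicalSpace G] : Continuous (r G) := by
  have h : (m G ∘ FreeTopGroup.of : G → Tau G) = r G := funext m_of
  rw [← h]
  exact continuous_coinduced_rng.comp FreeTopGroup.continuous_of

/-- The universal property of `τ(G)`. -/
theorem continuous_of_comp_r {G : Type u} [Group G] [TopologicalSpace G] {H : Type v} [Group H]
    [TopologicalSpace H] [IsTopologicalGroup H] {f : Tau G →* H}
    (hf : Continuous fun g : G => f (r G g)) : Continuous f := by
  refine continuous_coinduced_dom.2 ?_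
  have h : f.comp (m G) = FreeTopGroup.lift (fun g : G => f (r G g)) :=
    FreeTopGroup.hom_ext fun g => by
      rw [FreeTopGroup.lift_of, MonoidHom.comp_apply, m_of]
  have h' : (f ∘ m G : FreeTopGroup G → H) = FreeTopGroup.lift (fun g : G => f (r G g)) := by
    rw [← h]; rfl
  rw [h']
  exact FreeTopGroup.continuous_lift hf

/-- `τ` on morphisms: the same homomorphism. -/
def map {G : Type u} {H : Type v} [Group G] [TopologicalSpace G] [Group H] [TopologicalSpace H]
    (f : G →* H) (hf : Continuous f) : Tau G →ₜ* Tau H where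
  toMonoidHom := ((r H : H →* Tau H).comp f).comp ((r G).symm : Tau G →* G)
  continuous_toFun := continuous_of_comp_r (G := G)
    (f := ((r H : H →* Tau H).comp f).comp ((r G).symm : Tau G →* G))
    ((continuous_r H).comp hf)

end Tau

/-! ### The fundamental groups `π₁^qtop` and `π₁^τ` -/

/-- The quasitopological fundamental group: the fundamental group with the quotient topology from
the loop space `Ω(X, x)` (with the compact-open topology). -/
def QTopPi1 (X : Type u) [TopologicalSpace X] (x : X) : Type u := FundamentalGroup X x

namespace QTopPi1

variable {X : Type u} {Y : Type v} [TopologicalSpace X] [TopologicalSpace Y]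

noncomputable instance (x : X) : Group (QTopPi1 X x) :=
  inferInstanceAs (Group (FundamentalGroup X x))

/-- The canonical map `Ω(X, x) → π₁(X, x)`, sending a loop to its homotopy class. -/
def mk {x : X} (p : Path x x) : QTopPi1 X x :=
  FundamentalGroup.fromPath (Path.Homotopic.Quotient.mk p)

instance (x : X) : TopologicalSpace (QTopPi1 X x) :=
  TopologicalSpace.coinduced (mk (x := x)) inferInstance

/-- The homomorphism `[α] ↦ [f ∘ α]` induced by a based map `f : (X, x) → (Y, y)`. -/
noncomputable def map (f : C(X, Y)) {x : X} {y : Y} (h : f x = y) : QTopPi1 X x →* QTopPi1 Y y :=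
  FundamentalGroup.mapOfEq f h

theorem map_mk (f : C(X, Y)) {x : X} {y : Y} (h : f x = y) (p : Path x x) :
    map f h (mk p) = mk ((p.map f.continuous).cast h.symm h.symm) :=
  FundamentalGroup.mapOfEq_apply f h _

theorem continuous_map (f : C(X, Y)) {x : X} {y : Y} (h : f x = y) : Continuous (map f h) := by
  refine continuous_coinduced_dom.2 ?_
  have h' : (map f h ∘ mk : Path x x → QTopPi1 Y y) =
      mk ∘ fun p => (p.map f.continuous).cast h.symm h.symm := funext (map_mk f h)
  rw [h']
  refine continuous_coinduced_rng.comp ?_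
  refine continuous_induced_rng.2 ?_
  exact (ContinuousMap.continuous_postcomp f).comp continuous_induced_dom

end QTopPi1

/-- The topological fundamental group `π₁^τ(X, x) = τ(π₁^qtop(X, x))`. -/
abbrev TauPi1 (X : Type u) [TopologicalSpace X] (x : X) : Type u := Tau (QTopPi1 X x)

/-- The continuous homomorphism `f_* : π₁^τ(X, x) → π₁^τ(Y, y)` induced by a based map. -/
noncomputable def TauPi1.map {X : Type u} {Y : Type v} [TopologicalSpace X] [TopologicalSpace Y]
    (f : C(X, Y)) {x : X} {y : Y} (h : f x = y) : TauPi1 X x →ₜ* TauPi1 Y y :=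
  Tau.map (QTopPi1.map f h) (QTopPi1.continuous_map f h)

/-! ### The category of topological groups -/

/-- Topological groups (no separation axiom). -/
structure TopGrp : Type (u + 1) where
  carrier : Type u
  [group : Group carrier]
  [topologicalSpace : TopologicalSpace carrier]
  [isTopologicalGroup : IsTopologicalGroup carrier]

attribute [instance] TopGrp.group TopGrp.topologicalSpace TopGrp.isTopologicalGroup

/-- The category of topological groups and continuous homomorphisms. -/
instance : Category.{u} TopGrp.{u} where
  Hom A B := A.carrier →ₜ* B.carrier
  id A := ContinuousMonoidHom.id A.carrier
  comp f g := ContinuousMonoidHom.comp g f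

/-- A topological group as an object of the category of topological groups. -/
abbrev TopGrp.of (G : Type u) [Group G] [TopologicalSpace G] [IsTopologicalGroup G] : TopGrp.{u} :=
  ⟨G⟩

/-- A continuous homomorphism as a morphism of the category of topological groups. -/
abbrev TopGrp.ofHom {G H : Type u} [Group G] [TopologicalSpace G] [IsTopologicalGroup G] [Group H]
    [TopologicalSpace H] [IsTopologicalGroup H] (f : G →ₜ* H) : TopGrp.of G ⟶ TopGrp.of H := f

/-! ### Free topological products and amalgamation -/

/-- The free topological product `G₁ ∗ G₂`: the free product of groups with the quotient topology
along the canonical epimorphism `F_M(G₁ ⊔ G₂) → G₁ ∗ G₂`. -/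
def FreeTopProd (G₁ : Type u) (G₂ : Type v) [Group G₁] [Group G₂] : Type (max u v) :=
  Monoid.Coprod G₁ G₂

namespace FreeTopProd

variable (G₁ : Type u) (G₂ : Type v) [Group G₁] [Group G₂]

instance : Group (FreeTopProd G₁ G₂) := inferInstanceAs (Group (Monoid.Coprod G₁ G₂))

/-- The inclusion of the first factor. -/
def inl : G₁ →* FreeTopProd G₁ G₂ := Monoid.Coprod.inl

/-- The inclusion of the second factor. -/
def inr : G₂ →* FreeTopProd G₁ G₂ := Monoid.Coprod.inr

/-- The canonical epimorphism `F_M(G₁ ⊔ G₂) → G₁ ∗ G₂`. -/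
def k : FreeTopGroup (G₁ ⊕ G₂) →* FreeTopProd G₁ G₂ :=
  FreeTopGroup.lift (Sum.elim (inl G₁ G₂) (inr G₁ G₂))

instance [TopologicalSpace G₁] [TopologicalSpace G₂] : TopologicalSpace (FreeTopProd G₁ G₂) :=
  TopologicalSpace.coinduced (k G₁ G₂) inferInstance

end FreeTopProd

section Amalgam

variable {H : Type w} {G₁ : Type u} {G₂ : Type v} [Group H] [Group G₁] [Group G₂]

/-- The normal subgroup of `G₁ ∗ G₂` generated by the elements `φ₁(h) φ₂(h)⁻¹`. -/
def amalgamRel (φ₁ : H →* G₁) (φ₂ : H →* G₂) : Subgroup (FreeTopProd G₁ G₂) :=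
  Subgroup.normalClosure
    (Set.range fun h : H => FreeTopProd.inl G₁ G₂ (φ₁ h) * (FreeTopProd.inr G₁ G₂ (φ₂ h))⁻¹)

instance (φ₁ : H →* G₁) (φ₂ : H →* G₂) : (amalgamRel φ₁ φ₂).Normal :=
  Subgroup.normalClosure_normal

/-- The free topological product with amalgamation `G₁ ∗_H G₂`: the quotient of `G₁ ∗ G₂` that
identifies `φ₁(h)` with `φ₂(h)`, with the quotient topology. -/
abbrev AmalgTopProd (φ₁ : H →* G₁) (φ₂ : H →* G₂) : Type (max u v) :=
  FreeTopProd G₁ G₂ ⧸ amalgamRel φ₁ φ₂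

/-- The canonical homomorphism `G₁ → G₁ ∗_H G₂`. -/
def AmalgTopProd.inl (φ₁ : H →* G₁) (φ₂ : H →* G₂) : G₁ →* AmalgTopProd φ₁ φ₂ :=
  (QuotientGroup.mk' (amalgamRel φ₁ φ₂)).comp (FreeTopProd.inl G₁ G₂)

/-- The canonical homomorphism `G₂ → G₁ ∗_H G₂`. -/
def AmalgTopProd.inr (φ₁ : H →* G₁) (φ₂ : H →* G₂) : G₂ →* AmalgTopProd φ₁ φ₂ :=
  (QuotientGroup.mk' (amalgamRel φ₁ φ₂)).comp (FreeTopProd.inr G₁ G₂)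

end Amalgam

/-! ### Well-ended paths and wep-connected spaces -/

/-- A path `p` is well-ended if for every open neighborhood `𝒰` of `p` in the free path space
`P(X) = C(I, X)` there are open neighborhoods `V₀`, `V₁` of its endpoints such that any `a ∈ V₀`
and `b ∈ V₁` are joined by a path in `𝒰`. -/
def IsWellEnded {X : Type u} [TopologicalSpace X] (p : C(I, X)) : Prop :=
  ∀ 𝒰 : Set C(I, X), IsOpen 𝒰 → p ∈ 𝒰 →
    ∃ V₀ V₁ : Set X, IsOpen V₀ ∧ IsOpen V₁ ∧ p 0 ∈ V₀ ∧ p 1 ∈ V₁ ∧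
      ∀ a ∈ V₀, ∀ b ∈ V₁, ∃ q ∈ 𝒰, q 0 = a ∧ q 1 = b

/-- A space is wep-connected if any two points are joined by a well-ended path. -/
def WepConnected (X : Type u) [TopologicalSpace X] : Prop :=
  ∀ x y : X, ∃ p : C(I, X), IsWellEnded p ∧ p 0 = x ∧ p 1 = y

/-! ### The homomorphisms induced by inclusions -/

/-- The homomorphism `π₁^τ(A, x) → π₁^τ(B, x)` induced by the inclusion `A ↪ B` of subspaces. -/
noncomputable def TauPi1.incl {X : Type u} [TopologicalSpace X] {A B : Set X} (h : A ⊆ B) {x : X}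
    (hx : x ∈ A) : TauPi1 A ⟨x, hx⟩ →ₜ* TauPi1 B ⟨x, h hx⟩ :=
  TauPi1.map (⟨Set.inclusion h, continuous_inclusion h⟩ : C(A, B)) rfl

/-- The homomorphism `π₁^τ(A, x) → π₁^τ(X, x)` induced by the inclusion `A ↪ X`. -/
noncomputable def TauPi1.inclTop {X : Type u} [TopologicalSpace X] (A : Set X) {x : X}
    (hx : x ∈ A) : TauPi1 A ⟨x, hx⟩ →ₜ* TauPi1 X x :=
  TauPi1.map (⟨Subtype.val, continuous_subtype_val⟩ : C(A, X)) rfl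

/-! ### Extending locally defined path functionals -/

/-! A homomorphism from `Tau G` to a topological group `H` is continuous as soon as it is continuous
on `G`, and `QTopPi1` carries the quotient topology of the loop space. The universal property of the
pushout therefore splits into the classical van Kampen theorem and one continuity statement: the
glued homomorphism `F` must be continuous on loops of `X`.

The algebraic part is `exists_hom_of_open_cover`. Connecting arrows from the basepoint, chosen
compatibly on `U₁ ∩ U₂`, turn a path in `U₁` or `U₂` into a loop and so into an element of `H`. This
local rule is trivial on constant paths and respects squares, so it extends to all paths of `X` by
subdivision; the extension is multiplicative (`extend_trans`) and homotopy invariant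
(`extend_congr`). Uniqueness is `hom_eq_of_open_cover`.

The topological part is `continuous_hom_of_open_cover`. Loops inside `Uᵢ` form an open set of loops
of `X`, so `F` is continuous there because `fᵢ` is. A general loop `α` is cut into pieces lying in
the `Uᵢ`; where the set changes, a well-ended path `δ` in `U₁ ∩ U₂` joins the basepoint to the cut.
When `α` moves to a nearby `β`, the cut moves too, and well-endedness supplies a path near `δ`
reaching the new cut. Hence `F` of the loop stays a product of values at loops near fixed loops in
the `Uᵢ`, and joint continuity of multiplication in `H` concludes.

The amalgamated product has the same universal property, so it is isomorphic to `TauPi1 X x₀` as a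
topological group. -/

section Transport

variable {X : Type u} [TopologicalSpace X] {H : Type v} [Group H] {ι : Type w}

/-- The restriction of `p` to the segment from `s` to `t`, parametrized by `I`. -/
def pathSeg (p : C(I, X)) (s t : I) : C(I, X) :=
  ⟨fun x => p (Set.Icc.convexComb s t x), by fun_prop⟩

@[simp]
theorem pathSeg_apply (p : C(I, X)) (s t x : I) :
    pathSeg p s t x = p (Set.Icc.convexComb s t x) := rfl

theorem pathSeg_zero_one (p : C(I, X)) : pathSeg p 0 1 = p := by
  ext x; simp

theorem convexComb_mem_Icc {s t : I} (h : s ≤ t) (x : I) :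
    Set.Icc.convexComb s t x ∈ Set.Icc s t :=
  ⟨Set.Icc.le_convexComb h x, Set.Icc.convexComb_le h x⟩

theorem convexComb_convexComb (a b s t x : I) :
    Set.Icc.convexComb a b (Set.Icc.convexComb s t x) =
      Set.Icc.convexComb (Set.Icc.convexComb a b s) (Set.Icc.convexComb a b t) x := by
  ext
  simp only [Set.Icc.coe_convexComb]
  ring

theorem convexComb_mono {a b s t : I} (h : a ≤ b) (hst : s ≤ t) :
    Set.Icc.convexComb a b s ≤ Set.Icc.convexComb a b t := by
  rw [← Subtype.coe_le_coe] at h hst ⊢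
  simp only [Set.Icc.coe_convexComb]
  nlinarith

theorem pathSeg_pathSeg (p : C(I, X)) (a b s t : I) :
    pathSeg (pathSeg p a b) s t =
      pathSeg p (Set.Icc.convexComb a b s) (Set.Icc.convexComb a b t) := by
  ext x
  simp [convexComb_convexComb]

/-- A group-valued functional on paths that is trivial on constant paths and compatible with
squares lying in one of the sets `U i`. -/
structure IsLocalTransport (U : ι → Set X) (Ψ : C(I, X) → H) : Prop where
  const : ∀ x, Ψ (.const I x) = 1
  square : ∀ i (K : C(I × I, X)), (∀ z, K z ∈ U i) →
    Ψ (K.comp ⟨fun t => (1, t), by fun_prop⟩) * Ψ (K.comp ⟨fun t => (t, 0), by fun_prop⟩) =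
      Ψ (K.comp ⟨fun t => (t, 1), by fun_prop⟩) * Ψ (K.comp ⟨fun t => (0, t), by fun_prop⟩)

/-- `g` develops `p` up to time `T`: its increments over short segments of `p` are given by `Ψ`. -/
def IsDevelopment (U : ι → Set X) (Ψ : C(I, X) → H) (p : C(I, X)) (T : I) (g : I → H) : Prop :=
  ∀ s t, s ≤ t → t ≤ T → ∀ i, (∀ x ∈ Set.Icc s t, p x ∈ U i) → g t = Ψ (pathSeg p s t) * g s

namespace IsLocalTransport

variable {U : ι → Set X} {Ψ : C(I, X) → H}

/-- A triangle is a degenerate square: the map below fans `[s, t]` out to the point `r`, so one side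
is constant at `p r` and contributes `1`. -/
theorem pathSeg_mul (hΨ : IsLocalTransport U Ψ) (p : C(I, X)) {s t r : I} (hst : s ≤ t)
    (htr : t ≤ r) (i : ι) (h : ∀ x ∈ Set.Icc s r, p x ∈ U i) :
    Ψ (pathSeg p t r) * Ψ (pathSeg p s t) = Ψ (pathSeg p s r) := by
  have key := hΨ.square i
    ⟨fun z : I × I => p (Set.Icc.convexComb (Set.Icc.convexComb s t z.1) r z.2), by fun_prop⟩
    (fun z => h _ (by
      have h1 := convexComb_mem_Icc hst z.1
      have h2 := convexComb_mem_Icc (h1.2.trans htr) z.2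
      exact ⟨h1.1.trans h2.1, h2.2⟩))
  have e1 : ∀ K : C(I × I, X), K = ⟨fun z : I × I =>
      p (Set.Icc.convexComb (Set.Icc.convexComb s t z.1) r z.2), by fun_prop⟩ →
      K.comp ⟨fun t => (1, t), by fun_prop⟩ = pathSeg p t r ∧
      K.comp ⟨fun t => (t, 0), by fun_prop⟩ = pathSeg p s t ∧
      K.comp ⟨fun t => (t, 1), by fun_prop⟩ = .const I (p r) ∧
      K.comp ⟨fun t => (0, t), by fun_prop⟩ = pathSeg p s r := by
    rintro K rfl
    refine ⟨?_, ?_, ?_, ?_⟩ <;> ext x <;> simp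
  obtain ⟨h1, h2, h3, h4⟩ := e1 _ rfl
  rw [h1, h2, h3, h4, hΨ.const, one_mul] at key
  exact key

theorem pathSeg_self (hΨ : IsLocalTransport U Ψ) (p : C(I, X)) (s : I) :
    Ψ (pathSeg p s s) = 1 := by
  have : pathSeg p s s = .const I (p s) := by ext x; simp
  rw [this, hΨ.const]

/-- A Lebesgue subdivision puts each piece of `p` in one `U i`; a development up to `t n` is
prolonged over the next piece by the increments that `Ψ` prescribes. -/
theorem exists_isDevelopment (hΨ : IsLocalTransport U Ψ) (hU : ∀ i, IsOpen (U i))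
    (hcov : ∀ x, ∃ i, x ∈ U i) (p : C(I, X)) : ∃ g : I → H, g 0 = 1 ∧ IsDevelopment U Ψ p 1 g := by
  obtain ⟨t, ht0, htm, ⟨m, hm⟩, hc⟩ := exists_monotone_Icc_subset_open_cover_unitInterval
    (c := fun i => p ⁻¹' U i) (fun i => (hU i).preimage p.continuous)
    (fun x _ => by simpa using hcov (p x))
  suffices ∀ n, ∃ g : I → H, g 0 = 1 ∧ IsDevelopment U Ψ p (t n) g by
    simpa [hm m le_rfl] using this m
  intro n
  induction n with
  | zero =>
    refine ⟨1, rfl, fun a b hab hb i _ => ?_⟩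
    rw [ht0] at hb
    have hb0 : b = 0 := le_antisymm hb unitInterval.nonneg'
    have ha0 : a = 0 := le_antisymm (hb0 ▸ hab) unitInterval.nonneg'
    rw [ha0, hb0, hΨ.pathSeg_self, one_mul]
  | succ n ih =>
    obtain ⟨g, hg0, hg⟩ := ih
    obtain ⟨i, hi⟩ := hc n
    classical
    refine ⟨fun b => if b ≤ t n then g b else Ψ (pathSeg p (t n) b) * g (t n), ?_, ?_⟩
    · simpa [ht0] using hg0
    · intro a b hab hb j hj
      by_cases hbn : b ≤ t n
      · simpa [hbn, hab.trans hbn] using hg a b hab hbn j hj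
      · by_cases han : a ≤ t n
        · have hbn' := (not_le.1 hbn).le
          simp only [hbn, if_false, han, if_true]
          rw [hg a (t n) han le_rfl j fun x hx => hj x ⟨hx.1, hx.2.trans hbn'⟩, ← mul_assoc,
            hΨ.pathSeg_mul p han hbn' j hj]
        -- Here `U j` is known to contain only the part over `[a, b]`; additivity from `t n` needs
        -- the set `U i` containing the whole piece.
        · have han' := (not_le.1 han).le
          simp only [hbn, if_false, han]
          rw [← mul_assoc, hΨ.pathSeg_mul p han' hab i
            fun x hx => hi ⟨hx.1, hx.2.trans hb⟩]

theorem isDevelopment_unique (hU : ∀ i, IsOpen (U i)) (hcov : ∀ x, ∃ i, x ∈ U i) {p : C(I, X)}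
    {g g' : I → H} (hg : IsDevelopment U Ψ p 1 g) (hg' : IsDevelopment U Ψ p 1 g')
    (h0 : g 0 = g' 0) : g 1 = g' 1 := by
  obtain ⟨t, ht0, htm, ⟨m, hm⟩, hc⟩ := exists_monotone_Icc_subset_open_cover_unitInterval
    (c := fun i => p ⁻¹' U i) (fun i => (hU i).preimage p.continuous)
    (fun x _ => by simpa using hcov (p x))
  suffices ∀ n, g (t n) = g' (t n) by simpa [hm m le_rfl] using this m
  intro n
  induction n with
  | zero => rw [ht0, h0]
  | succ n ih =>
    obtain ⟨i, hi⟩ := hc n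
    rw [hg _ _ (htm n.le_succ) unitInterval.le_one' i fun x hx => hi hx,
      hg' _ _ (htm n.le_succ) unitInterval.le_one' i fun x hx => hi hx, ih]

open Classical in
/-- The extension of a local transport to all paths. -/
noncomputable def extend (_ : IsLocalTransport U Ψ) (p : C(I, X)) : H :=
  -- The default `1` never occurs for an open cover, by `exists_isDevelopment`.
  if h : ∃ g : I → H, g 0 = 1 ∧ IsDevelopment U Ψ p 1 g then h.choose 1 else 1

/-- Right multiplication by a constant preserves developments, so any initial value can be
normalized to `1`. This lets one development of `p` serve all its segments. -/
theorem extend_eq (hΨ : IsLocalTransport U Ψ) (hU : ∀ i, IsOpen (U i)) (hcov : ∀ x, ∃ i, x ∈ U i)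
    {p : C(I, X)} {g : I → H} (hg : IsDevelopment U Ψ p 1 g) :
    hΨ.extend p = g 1 * (g 0)⁻¹ := by
  have h := hΨ.exists_isDevelopment hU hcov p
  rw [extend, dif_pos h]
  refine isDevelopment_unique hU hcov (g' := fun t => g t * (g 0)⁻¹) h.choose_spec.2 ?_ ?_
  · intro s t hst ht i hi
    simp only
    rw [hg s t hst ht i hi, mul_assoc]
  · simp [h.choose_spec.1]

theorem extend_of_mem (hΨ : IsLocalTransport U Ψ) (hU : ∀ i, IsOpen (U i))
    (hcov : ∀ x, ∃ i, x ∈ U i) {p : C(I, X)} (i : ι) (hp : ∀ x, p x ∈ U i) :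
    hΨ.extend p = Ψ p := by
  obtain ⟨g, hg0, hg⟩ := hΨ.exists_isDevelopment hU hcov p
  rw [hΨ.extend_eq hU hcov hg, hg 0 1 unitInterval.nonneg' le_rfl i fun x _ => hp x,
    pathSeg_zero_one, mul_inv_cancel_right]

theorem extend_pathSeg (hΨ : IsLocalTransport U Ψ) (hU : ∀ i, IsOpen (U i))
    (hcov : ∀ x, ∃ i, x ∈ U i) {p : C(I, X)} {g : I → H} (hg : IsDevelopment U Ψ p 1 g) {a b : I}
    (hab : a ≤ b) : hΨ.extend (pathSeg p a b) = g b * (g a)⁻¹ := by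
  have : IsDevelopment U Ψ (pathSeg p a b) 1 fun t => g (Set.Icc.convexComb a b t) := by
    intro s t hst _ i hi
    rw [pathSeg_pathSeg]
    refine hg _ _ (convexComb_mono hab hst) unitInterval.le_one' i fun x hx => ?_
    have hx' := Set.Icc.eq_convexComb hx.1 hx.2
    rw [hx', ← convexComb_convexComb]
    exact hi _ (convexComb_mem_Icc hst _)
  rw [hΨ.extend_eq hU hcov this]
  simp

theorem extend_trans (hΨ : IsLocalTransport U Ψ) (hU : ∀ i, IsOpen (U i))
    (hcov : ∀ x, ∃ i, x ∈ U i) {a b c : X} (p : Path a b) (q : Path b c) :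
    hΨ.extend (p.trans q : C(I, X)) = hΨ.extend (q : C(I, X)) * hΨ.extend (p : C(I, X)) := by
  obtain ⟨g, hg0, hg⟩ := hΨ.exists_isDevelopment hU hcov (p.trans q : C(I, X))
  let m : I := ⟨1 / 2, by norm_num, by norm_num⟩
  have h1 : (p : C(I, X)) = pathSeg (p.trans q : C(I, X)) 0 m := by
    ext x
    have hx : (Set.Icc.convexComb 0 m x : ℝ) = x / 2 := by
      simp [m]; ring
    have hx1 := x.2.2
    change p x = (p.trans q) _
    rw [Path.trans_apply, dif_pos (by rw [hx]; linarith)]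
    congr 1; ext; simp [m]; ring
  have h2 : (q : C(I, X)) = pathSeg (p.trans q : C(I, X)) m 1 := by
    ext x
    have hx : (Set.Icc.convexComb m 1 x : ℝ) = 1 / 2 + x / 2 := by
      simp [m]; ring
    have hx0 := x.2.1
    change q x = (p.trans q) _
    rw [Path.trans_apply]
    -- Only the midpoint falls in the first branch; there `p` ends where `q` starts.
    split_ifs with hc
    · rw [hx] at hc
      have : x = 0 := by
        ext; rw [Set.Icc.coe_zero]; linarith
      subst this
      rw [q.source, eq_comm]
      convert p.target using 2
      ext; simp [m]
    · congr 1; ext; simp [m]; ring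
  rw [h1, h2, hΨ.extend_pathSeg hU hcov hg unitInterval.nonneg',
    hΨ.extend_pathSeg hU hcov hg unitInterval.le_one', hΨ.extend_eq hU hcov hg]
  group

/-- Developments along neighbouring rows of a grid are related by transport between the rows. -/
theorem development_row (hΨ : IsLocalTransport U Ψ) (K : C(I × I, X)) {s s' : I} (hs : s ≤ s')
    {g g' : I → H} (hg : IsDevelopment U Ψ (K.comp ⟨fun t => (s, t), by fun_prop⟩) 1 g)
    (hg' : IsDevelopment U Ψ (K.comp ⟨fun t => (s', t), by fun_prop⟩) 1 g') {t : ℕ → I}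
    (ht0 : t 0 = 0) (htm : Monotone t) (h0 : g 0 = g' 0) (hK0 : ∀ s, K (s, 0) = K (0, 0))
    (hc : ∀ n, ∃ i, Set.Icc s s' ×ˢ Set.Icc (t n) (t (n + 1)) ⊆ K ⁻¹' U i) (n : ℕ) :
    g' (t n) = Ψ (pathSeg (K.comp ⟨fun r => (r, t n), by fun_prop⟩) s s') * g (t n) := by
  induction n with
  | zero =>
    have : pathSeg (K.comp ⟨fun r => (r, t 0), by fun_prop⟩) s s' = .const I (K (0, 0)) := by
      ext x; simp [ht0, hK0]
    rw [this, hΨ.const, ht0, h0, one_mul]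
  | succ n ih =>
    obtain ⟨i, hi⟩ := hc n
    have htn := htm n.le_succ
    -- The coordinates are swapped: the first one of the square runs along the rows, the second one
    -- from row `s` to row `s'`.
    have key := hΨ.square i (K.comp ⟨fun z : I × I =>
        (Set.Icc.convexComb s s' z.2, Set.Icc.convexComb (t n) (t (n + 1)) z.1), by fun_prop⟩)
      (fun z => hi ⟨convexComb_mem_Icc hs _, convexComb_mem_Icc htn _⟩)
    have e1 : ∀ L : C(I × I, X), L = (K.comp ⟨fun z : I × I =>
        (Set.Icc.convexComb s s' z.2, Set.Icc.convexComb (t n) (t (n + 1)) z.1), by fun_prop⟩) →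
        L.comp ⟨fun t => (1, t), by fun_prop⟩ =
          pathSeg (K.comp ⟨fun r => (r, t (n + 1)), by fun_prop⟩) s s' ∧
        L.comp ⟨fun t => (t, 0), by fun_prop⟩ =
          pathSeg (K.comp ⟨fun t => (s, t), by fun_prop⟩) (t n) (t (n + 1)) ∧
        L.comp ⟨fun t => (t, 1), by fun_prop⟩ =
          pathSeg (K.comp ⟨fun t => (s', t), by fun_prop⟩) (t n) (t (n + 1)) ∧
        L.comp ⟨fun t => (0, t), by fun_prop⟩ =
          pathSeg (K.comp ⟨fun r => (r, t n), by fun_prop⟩) s s' := by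
      rintro L rfl
      refine ⟨?_, ?_, ?_, ?_⟩ <;> ext x <;> simp
    obtain ⟨h1, h2, h3, h4⟩ := e1 _ rfl
    rw [h1, h2, h3, h4] at key
    rw [hg' (t n) (t (n + 1)) htn unitInterval.le_one' i
        fun x hx => hi ⟨⟨hs, le_rfl⟩, hx⟩, ih, ← mul_assoc, ← key, mul_assoc,
      ← hg (t n) (t (n + 1)) htn unitInterval.le_one' i fun x hx => hi ⟨⟨le_rfl, hs⟩, hx⟩]

/-- On a fine grid, consecutive rows of the homotopy differ by the transport along their last
vertical edge, and that edge is constant because endpoints are fixed. -/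
theorem extend_congr (hΨ : IsLocalTransport U Ψ) (hU : ∀ i, IsOpen (U i))
    (hcov : ∀ x, ∃ i, x ∈ U i) {a b : X} {p q : Path a b} (h : p.Homotopic q) :
    hΨ.extend (p : C(I, X)) = hΨ.extend (q : C(I, X)) := by
  obtain ⟨F⟩ := h
  let K : C(I × I, X) := F.toContinuousMap
  obtain ⟨t, ht0, htm, ⟨m, hm⟩, hc⟩ := exists_monotone_Icc_subset_open_cover_unitInterval_prod_self
    (c := fun i => K ⁻¹' U i) (fun i => (hU i).preimage K.continuous)
    (fun x _ => by simpa using hcov (K x))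
  have hK0 : ∀ s, K (s, 0) = a := fun s => F.source s
  have hK1 : ∀ s, K (s, 1) = b := fun s => F.target s
  let row : I → C(I, X) := fun s => K.comp ⟨fun t => (s, t), by fun_prop⟩
  have hp : (p : C(I, X)) = row 0 := by
    ext x; exact (F.apply_zero x).symm
  have hq : (q : C(I, X)) = row 1 := by
    ext x; exact (F.apply_one x).symm
  have step : ∀ n, hΨ.extend (row (t n)) = hΨ.extend (row 0) := by
    intro n
    induction n with
    | zero => rw [ht0]
    | succ n ih =>
      rw [← ih]
      obtain ⟨g, hg0, hg⟩ := hΨ.exists_isDevelopment hU hcov (row (t n))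
      obtain ⟨g', hg0', hg'⟩ := hΨ.exists_isDevelopment hU hcov (row (t (n + 1)))
      have := hΨ.development_row K (htm n.le_succ) hg hg' ht0 htm (hg0.trans hg0'.symm)
        (fun s => (hK0 s).trans (hK0 0).symm) (hc n) m
      have hconst : pathSeg (K.comp ⟨fun r => (r, t m), by fun_prop⟩) (t n) (t (n + 1)) =
          .const I b := by
        ext x; simp [hm m le_rfl, hK1]
      rw [hconst, hΨ.const, one_mul, hm m le_rfl] at this
      rw [hΨ.extend_eq hU hcov hg, hΨ.extend_eq hU hcov hg', hg0, hg0', this]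
  rw [hp, hq, ← step m, hm m le_rfl]

end IsLocalTransport

end Transport

/-! ### The van Kampen theorem for fundamental groups -/

section BasedTransport

variable {Y : Type u} [TopologicalSpace Y] {H : Type v} [Group H]

/-- The class of a path in the fundamental groupoid. -/
def pathArrow (q : C(I, Y)) :
    FundamentalGroupoid.mk (q 0) ⟶ FundamentalGroupoid.mk (q 1) :=
  FundamentalGroupoid.fromPath (Path.Homotopic.Quotient.mk ⟨q, rfl, rfl⟩)

/-- In the contractible square `I × I` parallel arrows of the fundamental groupoid coincide; `K`
carries this identity to `Y`. -/
theorem pathArrow_square (K : C(I × I, Y)) :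
    (pathArrow (K.comp ⟨fun t => (t, 0), by fun_prop⟩) ≫
      pathArrow (K.comp ⟨fun t => (1, t), by fun_prop⟩) :
        FundamentalGroupoid.mk (K (0, 0)) ⟶ FundamentalGroupoid.mk (K (1, 1))) =
      pathArrow (K.comp ⟨fun t => (0, t), by fun_prop⟩) ≫
      pathArrow (K.comp ⟨fun t => (t, 1), by fun_prop⟩) := by
  have : ContractibleSpace I := (convex_Icc (0 : ℝ) 1).contractibleSpace ⟨0, by simp⟩
  have h : (pathArrow (⟨fun t => (t, 0), by fun_prop⟩ : C(I, I × I)) ≫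
      pathArrow (⟨fun t => (1, t), by fun_prop⟩ : C(I, I × I)) :
        FundamentalGroupoid.mk ((0, 0) : I × I) ⟶ FundamentalGroupoid.mk ((1, 1) : I × I)) =
      pathArrow (⟨fun t => (0, t), by fun_prop⟩ : C(I, I × I)) ≫
      pathArrow (⟨fun t => (t, 1), by fun_prop⟩ : C(I, I × I)) :=
    Subsingleton.elim (α := Path.Homotopic.Quotient ((0, 0) : I × I) (1, 1)) _ _
  have h' := congrArg (FundamentalGroupoid.map K).map h
  erw [Functor.map_comp, Functor.map_comp] at h'
  exact h'

/-- The value of `f` on the loop obtained from `q` by joining its endpoints to the basepoint. -/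
noncomputable def basedTransport {y₀ : Y} (f : FundamentalGroup Y y₀ →* H)
    (γ : ∀ y, FundamentalGroupoid.mk y₀ ⟶ FundamentalGroupoid.mk y) (q : C(I, Y)) : H :=
  f (γ (q 0) ≫ pathArrow q ≫ inv (γ (q 1)))

theorem basedTransport_const {y₀ : Y} (f : FundamentalGroup Y y₀ →* H)
    (γ : ∀ y, FundamentalGroupoid.mk y₀ ⟶ FundamentalGroupoid.mk y) (y : Y) :
    basedTransport f γ (.const I y) = 1 := by
  have : γ y ≫ 𝟙 (FundamentalGroupoid.mk y) ≫ inv (γ y) = 𝟙 _ := by simp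
  exact (congrArg f this).trans f.map_one

/-- The connecting arrows cancel at the middle corner of each composite. Products in the fundamental
group are composites in reverse order. -/
theorem basedTransport_square {y₀ : Y} (f : FundamentalGroup Y y₀ →* H)
    (γ : ∀ y, FundamentalGroupoid.mk y₀ ⟶ FundamentalGroupoid.mk y) (K : C(I × I, Y)) :
    basedTransport f γ (K.comp ⟨fun t => (1, t), by fun_prop⟩) *
        basedTransport f γ (K.comp ⟨fun t => (t, 0), by fun_prop⟩) =
      basedTransport f γ (K.comp ⟨fun t => (t, 1), by fun_prop⟩) *
        basedTransport f γ (K.comp ⟨fun t => (0, t), by fun_prop⟩) := by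
  have aux : ∀ {a b c d : FundamentalGroupoid Y} (γa : FundamentalGroupoid.mk y₀ ⟶ a)
      (γb : FundamentalGroupoid.mk y₀ ⟶ b) (γc : FundamentalGroupoid.mk y₀ ⟶ c)
      (γd : FundamentalGroupoid.mk y₀ ⟶ d) (p : a ⟶ b) (q : b ⟶ d) (p' : a ⟶ c) (q' : c ⟶ d),
      p ≫ q = p' ≫ q' → f (γb ≫ q ≫ inv γd) * f (γa ≫ p ≫ inv γb) =
        f (γc ≫ q' ≫ inv γd) * f (γa ≫ p' ≫ inv γc) := by
    intro a b c d γa γb γc γd p q p' q' h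
    rw [← map_mul, ← map_mul, End.mul_def, End.mul_def]
    simp only [Category.assoc, IsIso.inv_hom_id_assoc]
    rw [reassoc_of% h]
  exact aux (γ (K (0, 0))) (γ (K (1, 0))) (γ (K (0, 1))) (γ (K (1, 1))) _ _ _ _
    (pathArrow_square K)

theorem basedTransport_path {y₀ : Y} (f : FundamentalGroup Y y₀ →* H)
    (γ : ∀ y, FundamentalGroupoid.mk y₀ ⟶ FundamentalGroupoid.mk y) (h : γ y₀ = 𝟙 _)
    (p : Path y₀ y₀) :
    basedTransport f γ (p : C(I, Y)) =
      f (FundamentalGroup.fromPath (Path.Homotopic.Quotient.mk p)) := by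
  have aux : ∀ (q : C(I, Y)) (h0 : q 0 = y₀) (h1 : q 1 = y₀), basedTransport f γ q =
      f (FundamentalGroup.fromPath (Path.Homotopic.Quotient.mk ⟨q, h0, h1⟩)) := by
    intro q h0 h1
    have e : γ (q 0) ≫ pathArrow q ≫ inv (γ (q 1)) = FundamentalGroupoid.fromPath
        (Path.Homotopic.Quotient.mk ⟨q, h0, h1⟩) := by
      have e : ∀ y (hy : y = y₀), γ y = eqToHom congr(FundamentalGroupoid.mk $hy.symm) := by
        rintro y rfl; exact h
      rw [e _ h0, e _ h1, inv_eqToHom]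
      exact FundamentalGroupoid.conj_eqToHom (p := pathArrow q) h0.symm h1.symm
    exact congrArg f e
  exact aux p p.source p.target

/-- Naturality of based transport; for `W = U₁ ∩ U₂` it makes the two local rules agree on paths in
the intersection. -/
theorem basedTransport_comp {W : Type w} [TopologicalSpace W] (j : C(W, Y)) {w₀ : W}
    (f : FundamentalGroup Y (j w₀) →* H) (g : FundamentalGroup W w₀ →* H)
    (hfg : ∀ x, f (FundamentalGroup.map j w₀ x) = g x)
    (γ : ∀ y, FundamentalGroupoid.mk (j w₀) ⟶ FundamentalGroupoid.mk y)
    (δ : ∀ y, FundamentalGroupoid.mk w₀ ⟶ FundamentalGroupoid.mk y)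
    (h : ∀ y, γ (j y) = (FundamentalGroupoid.map j).map (δ y)) (q : C(I, W)) :
    basedTransport f γ (j.comp q) = basedTransport g δ q := by
  rw [basedTransport, basedTransport, ← hfg]
  have e : (FundamentalGroupoid.map j).map (δ (q 0) ≫ pathArrow q ≫ inv (δ (q 1))) =
      (FundamentalGroupoid.map j).map (δ (q 0)) ≫ (FundamentalGroupoid.map j).map (pathArrow q) ≫
        inv ((FundamentalGroupoid.map j).map (δ (q 1))) := by
    rw [Functor.map_comp, Functor.map_comp, Functor.map_inv]
  have aux : ∀ {a b c : FundamentalGroupoid Y} {α α' : a ⟶ b} {β β' : a ⟶ c} (p : b ⟶ c),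
      α = α' → β = β' → α ≫ p ≫ inv β = α' ≫ p ≫ inv β' := by
    rintro _ _ _ _ _ _ _ _ rfl rfl; rfl
  exact congrArg f ((aux ((FundamentalGroupoid.map j).map (pathArrow q)) (h (q 0))
    (h (q 1))).trans e.symm)

end BasedTransport

/-- Arrows are prescribed on `W` and completed arbitrarily elsewhere, so that two sets containing
`W` can use compatible choices. -/
theorem exists_arrow_extension {X : Type u} [TopologicalSpace X] {W U : Set X} (h : W ⊆ U)
    (hU : IsPathConnected U) {x₀ : X} (hx : x₀ ∈ W)
    (δ : ∀ w : W, FundamentalGroupoid.mk (⟨x₀, hx⟩ : W) ⟶ FundamentalGroupoid.mk w) :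
    ∃ γ : ∀ y : U, FundamentalGroupoid.mk (⟨x₀, h hx⟩ : U) ⟶ FundamentalGroupoid.mk y,
      ∀ w : W, γ (Set.inclusion h w) =
        (FundamentalGroupoid.map (⟨Set.inclusion h, continuous_inclusion h⟩ : C(W, U))).map
          (δ w) := by
  classical
  have := isPathConnected_iff_pathConnectedSpace.1 hU
  refine ⟨fun y => if hy : (y : X) ∈ W then
      (FundamentalGroupoid.map (⟨Set.inclusion h, continuous_inclusion h⟩ : C(W, U))).map
          (δ ⟨y, hy⟩)
    else FundamentalGroupoid.fromPath (Path.Homotopic.Quotient.mk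
      (PathConnectedSpace.somePath _ y)), fun w => ?_⟩
  exact dif_pos w.2

/-! ### Gluing homomorphisms over two open sets -/

section VanKampen

variable {X : Type u} [TopologicalSpace X] {H : Type v} [Group H]

/-- A path lying in `U`, as a path in the subspace `U`. -/
def pathRestrict {U : Set X} (p : C(I, X)) (h : ∀ t, p t ∈ U) : C(I, U) :=
  ⟨fun t => ⟨p t, h t⟩, by fun_prop⟩

theorem QTopPi1.mk_trans {x : X} (p q : Path x x) :
    QTopPi1.mk (p.trans q) = QTopPi1.mk q * QTopPi1.mk p := rfl

theorem QTopPi1.mk_eq {x : X} {p q : Path x x} (h : p.Homotopic q) :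
    QTopPi1.mk p = QTopPi1.mk q := Quotient.sound h

theorem QTopPi1.mk_surjective {x : X} : Function.Surjective (QTopPi1.mk (x := x)) :=
  Quotient.mk_surjective

/-- Homomorphisms on the fundamental groups of two path connected open sets that agree on the
path connected intersection extend to the union. -/
theorem exists_hom_of_open_cover {x₀ : X} {U₁ U₂ : Set X} (hU₁ : IsOpen U₁) (hU₂ : IsOpen U₂)
    (hcover : U₁ ∪ U₂ = Set.univ) (hx : x₀ ∈ U₁ ∩ U₂) (hpc₁ : IsPathConnected U₁)
    (hpc₂ : IsPathConnected U₂) (hpc : IsPathConnected (U₁ ∩ U₂))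
    (f₁ : QTopPi1 U₁ ⟨x₀, hx.1⟩ →* H) (f₂ : QTopPi1 U₂ ⟨x₀, hx.2⟩ →* H)
    (hf : ∀ p : Path (⟨x₀, hx⟩ : (U₁ ∩ U₂ : Set X)) ⟨x₀, hx⟩,
      f₁ (QTopPi1.mk (p.map (continuous_inclusion Set.inter_subset_left))) =
        f₂ (QTopPi1.mk (p.map (continuous_inclusion Set.inter_subset_right)))) :
    ∃ F : QTopPi1 X x₀ →* H,
      (∀ p : Path (⟨x₀, hx.1⟩ : U₁) ⟨x₀, hx.1⟩,
        F (QTopPi1.mk (p.map continuous_subtype_val)) = f₁ (QTopPi1.mk p)) ∧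
      (∀ p : Path (⟨x₀, hx.2⟩ : U₂) ⟨x₀, hx.2⟩,
        F (QTopPi1.mk (p.map continuous_subtype_val)) = f₂ (QTopPi1.mk p)) := by
  classical
  have := isPathConnected_iff_pathConnectedSpace.1 hpc
  let w₀ : (U₁ ∩ U₂ : Set X) := ⟨x₀, hx⟩
  obtain ⟨δ, hδ⟩ : ∃ δ : ∀ w, FundamentalGroupoid.mk w₀ ⟶ FundamentalGroupoid.mk w,
      δ w₀ = 𝟙 _ := by
    let δ' : ∀ w, FundamentalGroupoid.mk w₀ ⟶ FundamentalGroupoid.mk w := fun w =>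
      FundamentalGroupoid.fromPath (Path.Homotopic.Quotient.mk (PathConnectedSpace.somePath w₀ w))
    -- Correcting by `δ' w₀` makes the arrow at the basepoint trivial, so that loops are not
    -- conjugated.
    exact ⟨fun w => inv (δ' w₀) ≫ δ' w, by simp⟩
  let j₁ : C((U₁ ∩ U₂ : Set X), U₁) := ⟨_, continuous_inclusion Set.inter_subset_left⟩
  let j₂ : C((U₁ ∩ U₂ : Set X), U₂) := ⟨_, continuous_inclusion Set.inter_subset_right⟩
  obtain ⟨γ₁, hγ₁⟩ := exists_arrow_extension Set.inter_subset_left hpc₁ hx δ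
  obtain ⟨γ₂, hγ₂⟩ := exists_arrow_extension Set.inter_subset_right hpc₂ hx δ
  let g₁ : FundamentalGroup U₁ ⟨x₀, hx.1⟩ →* H := f₁
  let g₂ : FundamentalGroup U₂ ⟨x₀, hx.2⟩ →* H := f₂
  have hγ₁0 : γ₁ ⟨x₀, hx.1⟩ = 𝟙 _ :=
    (hγ₁ w₀).trans ((congrArg _ hδ).trans ((FundamentalGroupoid.map j₁).map_id _))
  have hγ₂0 : γ₂ ⟨x₀, hx.2⟩ = 𝟙 _ :=
    (hγ₂ w₀).trans ((congrArg _ hδ).trans ((FundamentalGroupoid.map j₂).map_id _))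
  -- The preference for `U₁` is harmless by `hΨ₂`, and the value `1` is never consulted for a path
  -- inside `U₁` or `U₂`.
  let Ψ : C(I, X) → H := fun p =>
    if h : ∀ t, p t ∈ U₁ then basedTransport g₁ γ₁ (pathRestrict p h)
    else if h : ∀ t, p t ∈ U₂ then basedTransport g₂ γ₂ (pathRestrict p h) else 1
  have hΨ₁ : ∀ (p : C(I, X)) (h : ∀ t, p t ∈ U₁),
      Ψ p = basedTransport g₁ γ₁ (pathRestrict p h) := fun p h => dif_pos h
  have hΨ₂ : ∀ (p : C(I, X)) (h : ∀ t, p t ∈ U₂),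
      Ψ p = basedTransport g₂ γ₂ (pathRestrict p h) := by
    intro p h
    by_cases h' : ∀ t, p t ∈ U₁
    · rw [hΨ₁ p h']
      -- Both values equal the transport of this common restriction of `g₁` and `g₂` to the
      -- intersection.
      let g : FundamentalGroup (U₁ ∩ U₂ : Set X) w₀ →* H :=
        MonoidHom.comp g₁ (FundamentalGroup.map j₁ w₀)
      have e₁ := basedTransport_comp j₁ (w₀ := w₀) g₁ g (fun _ => rfl) γ₁ δ hγ₁
        (pathRestrict p fun t => ⟨h' t, h t⟩)
      have e₂ := basedTransport_comp j₂ (w₀ := w₀) g₂ g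
        (fun x => by
          obtain ⟨q, rfl⟩ := QTopPi1.mk_surjective x
          exact (hf q).symm) γ₂ δ hγ₂
        (pathRestrict p fun t => ⟨h' t, h t⟩)
      exact e₁.trans e₂.symm
    · exact (dif_neg h').trans (dif_pos h)
  let U : Bool → Set X := fun b => cond b U₁ U₂
  have hU : ∀ b, IsOpen (U b) := by rintro (_ | _) <;> assumption
  have hcov : ∀ x, ∃ b, x ∈ U b := fun x => by
    rcases (hcover ▸ Set.mem_univ x : x ∈ U₁ ∪ U₂) with h | h
    · exact ⟨true, h⟩
    · exact ⟨false, h⟩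
  have hΨ : IsLocalTransport U Ψ := by
    refine ⟨fun x => ?_, ?_⟩
    · obtain ⟨_ | _, h⟩ := hcov x
      · exact (hΨ₂ _ fun _ => h).trans (basedTransport_const g₂ γ₂ ⟨x, h⟩)
      · exact (hΨ₁ _ fun _ => h).trans (basedTransport_const g₁ γ₁ ⟨x, h⟩)
    · rintro (_ | _) K hK
      · rw [hΨ₂ _ fun t => hK _, hΨ₂ _ fun t => hK _, hΨ₂ _ fun t => hK _, hΨ₂ _ fun t => hK _]
        exact basedTransport_square g₂ γ₂ ⟨fun z => ⟨K z, hK z⟩, by fun_prop⟩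
      · rw [hΨ₁ _ fun t => hK _, hΨ₁ _ fun t => hK _, hΨ₁ _ fun t => hK _, hΨ₁ _ fun t => hK _]
        exact basedTransport_square g₁ γ₁ ⟨fun z => ⟨K z, hK z⟩, by fun_prop⟩
  let F : QTopPi1 X x₀ →* H := MonoidHom.mk'
    (Quotient.lift (fun p : Path x₀ x₀ => hΨ.extend (p : C(I, X)))
      fun p q h => hΨ.extend_congr hU hcov h) (by
      intro a b
      obtain ⟨p, rfl⟩ := QTopPi1.mk_surjective a
      obtain ⟨q, rfl⟩ := QTopPi1.mk_surjective b
      rw [← QTopPi1.mk_trans]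
      exact hΨ.extend_trans hU hcov q p)
  refine ⟨F, fun p => ?_, fun p => ?_⟩
  · have hp : ∀ t, (p.map continuous_subtype_val : C(I, X)) t ∈ U true := fun t => (p t).2
    exact (hΨ.extend_of_mem hU hcov true hp).trans
      ((hΨ₁ _ hp).trans (basedTransport_path g₁ γ₁ hγ₁0 p))
  · have hp : ∀ t, (p.map continuous_subtype_val : C(I, X)) t ∈ U false := fun t => (p t).2
    exact (hΨ.extend_of_mem hU hcov false hp).trans
      ((hΨ₂ _ hp).trans (basedTransport_path g₂ γ₂ hγ₂0 p))

end VanKampen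

/-! ### Loops assembled from small pieces -/

section Pieces

variable {X : Type u} [TopologicalSpace X]

/-- Follow `β` up to time `t` and return to its origin along `γ`. -/
noncomputable def truncatedLoop {a b x : X} (β : Path a b) (h : x = β 0) (t : I)
    (γ : Path x (β t)) : Path x x :=
  ((β.subpath 0 t).cast h rfl).trans γ.symm

theorem mk_truncatedLoop_zero {a b x : X} (β : Path a b) (h : x = β 0) (γ : Path x (β 0)) :
    QTopPi1.mk (truncatedLoop β h 0 γ) = QTopPi1.mk (γ.symm.cast h rfl) := by
  subst h
  refine QTopPi1.mk_eq ?_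
  rw [truncatedLoop, Path.subpath_self]
  exact Path.Homotopic.refl_trans _

theorem mk_truncatedLoop_one {a b x : X} (β : Path a b) (h : x = β 0) (h' : β 1 = x) (ha : x = a)
    (hb : x = b) :
    QTopPi1.mk (truncatedLoop β h 1 ((Path.refl x).cast rfl h')) =
      QTopPi1.mk (β.cast ha hb) := by
  subst ha
  subst hb
  refine QTopPi1.mk_eq ?_
  have e : truncatedLoop β h 1 ((Path.refl x).cast rfl h') = β.trans (Path.refl x) := by
    ext t
    simp [truncatedLoop, Path.trans_apply]
  rw [e]
  exact Path.Homotopic.trans_refl _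

/-- The return path first retraces `β` from `s` to `t`, which only moves the cut. This handles
progress within one member of a cover. -/
theorem mk_truncatedLoop_trans_subpath {a b x : X} (β : Path a b) (h : x = β 0) (s t : I)
    (γ : Path x (β t)) :
    QTopPi1.mk (truncatedLoop β h s (γ.trans (β.subpath t s))) =
      QTopPi1.mk (truncatedLoop β h t γ) := by
  subst h
  refine QTopPi1.mk_eq ?_
  rw [truncatedLoop, truncatedLoop, Path.trans_symm, Path.symm_subpath]
  refine (Path.Homotopic.trans_assoc _ _ _).symm.trans ?_
  exact Path.Homotopic.hcomp ⟨Path.Homotopy.subpathTransSubpath β 0 s t⟩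
    (Path.Homotopic.refl _)

/-- Inserting `δ` backwards and forwards at the cut changes the return path at the cost of a loop.
This handles the passage from one member of a cover to another. -/
theorem mk_truncatedLoop_eq_mul {a b x : X} (β : Path a b) (h : x = β 0) (t : I)
    (γ δ : Path x (β t)) :
    QTopPi1.mk (truncatedLoop β h t γ) =
      QTopPi1.mk (δ.trans γ.symm) * QTopPi1.mk (truncatedLoop β h t δ) := by
  rw [← QTopPi1.mk_trans]
  refine QTopPi1.mk_eq ?_
  rw [truncatedLoop, truncatedLoop]
  refine Path.Homotopic.trans ?_ (Path.Homotopic.trans_assoc _ _ _).symm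
  refine Path.Homotopic.hcomp (Path.Homotopic.refl _) ?_
  refine Path.Homotopic.trans ?_ (Path.Homotopic.trans_assoc _ _ _)
  exact (Path.Homotopic.refl_trans _).symm.trans
    (Path.Homotopic.hcomp (Path.Homotopic.symm_trans δ).symm (Path.Homotopic.refl _))

/-! ### Induction along a loop through an open cover -/

/-- Propagation of a property of times along a path, through the pieces of an open cover. -/
theorem path_cover_induction {ι : Type w} {U : ι → Set X} (hU : ∀ i, IsOpen (U i))
    (hcov : ∀ x, ∃ i, x ∈ U i) (α : C(I, X)) {P : ι → I → Prop} (h0 : ∀ i, P i 0)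
    (hstep : ∀ i s t, s ≤ t → (∀ x ∈ Set.Icc s t, α x ∈ U i) → P i s → P i t)
    (hswitch : ∀ i j t, α t ∈ U i → α t ∈ U j → P i t → P j t) (i : ι) (hi : α 1 ∈ U i) :
    P i 1 := by
  obtain ⟨t, ht0, htm, ⟨m, hm⟩, hc⟩ := exists_monotone_Icc_subset_open_cover_unitInterval
    (c := fun i => α ⁻¹' U i) (fun i => (hU i).preimage α.continuous)
    (fun x _ => by simpa using hcov (α x))
  -- All `i` at once, since the next piece may lie in a different set.
  have key : ∀ n i, α (t n) ∈ U i → P i (t n) := by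
    intro n
    induction n with
    | zero => intro i _; rw [ht0]; exact h0 i
    | succ n ih =>
      intro i hi
      obtain ⟨j, hj⟩ := hc n
      have hn := htm n.le_succ
      exact hswitch j i _ (hj ⟨hn, le_rfl⟩) hi
        (hstep j _ _ hn (fun x hx => hj hx) (ih j (hj ⟨le_rfl, hn⟩)))
  have := key m i
  rw [hm m le_rfl] at this
  exact this hi

variable {H : Type v} [Group H]

/-- Homomorphisms agreeing on loops inside the members of an open cover agree. -/
theorem hom_eq_of_open_cover {ι : Type w} {U : ι → Set X} (hU : ∀ i, IsOpen (U i))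
    (hcov : ∀ x, ∃ i, x ∈ U i) {x₀ : X} (hx : ∀ i, x₀ ∈ U i)
    (hpc : ∀ i j, ∀ y ∈ U i ∩ U j, ∃ δ : Path x₀ y, ∀ t, δ t ∈ U i ∩ U j)
    {F F' : QTopPi1 X x₀ →* H}
    (h : ∀ i (p : Path x₀ x₀), (∀ t, p t ∈ U i) → F (QTopPi1.mk p) = F' (QTopPi1.mk p)) :
    F = F' := by
  ext x
  obtain ⟨α, rfl⟩ := QTopPi1.mk_surjective x
  obtain ⟨i, hi⟩ := hcov x₀
  have key := path_cover_induction hU hcov (α : C(I, X))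
    (P := fun i t => ∀ γ : Path x₀ (α t), (∀ s, γ s ∈ U i) →
      F (QTopPi1.mk (truncatedLoop α α.source.symm t γ)) =
        F' (QTopPi1.mk (truncatedLoop α α.source.symm t γ)))
    (fun i γ hγ => by
      rw [mk_truncatedLoop_zero]
      exact h i _ fun s => hγ _)
    (fun i s t hst hα hP γ hγ => by
      rw [← mk_truncatedLoop_trans_subpath α _ s t γ]
      refine hP _ fun r => ?_
      have : (γ.trans (α.subpath t s)) r ∈ Set.range (γ.trans (α.subpath t s)) := ⟨r, rfl⟩
      rw [Path.trans_range, Path.range_subpath_of_ge _ _ _ hst] at this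
      rcases this with ⟨r, hr⟩ | ⟨r, hr, hr'⟩
      · exact hr ▸ hγ r
      · exact hr' ▸ hα r hr)
    (fun i j t hi hj hP γ hγ => by
      -- With `δ` in both sets, the induction hypothesis in `U i` applies to `δ`, and the leftover
      -- loop lies in `U j`.
      obtain ⟨δ, hδ⟩ := hpc i j _ ⟨hi, hj⟩
      rw [mk_truncatedLoop_eq_mul α _ t γ δ, map_mul, map_mul, hP δ fun s => (hδ s).1]
      congr 1
      refine h j _ fun r => ?_
      have : (δ.trans γ.symm) r ∈ Set.range (δ.trans γ.symm) := ⟨r, rfl⟩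
      rw [Path.trans_range, Path.symm_range] at this
      rcases this with ⟨r, hr⟩ | ⟨r, hr⟩
      · exact hr ▸ (hδ r).2
      · exact hr ▸ hγ r)
    i (by simpa using hx i) ((Path.refl x₀).cast rfl α.target) (fun _ => hx i)
  rw [mk_truncatedLoop_one α _ _ rfl rfl] at key
  exact key

/-! ### Continuity of homomorphisms on the loop space -/

/-- Concatenation of paths with varying endpoints is continuous. -/
theorem eventually_trans_mem {a b c : X} (p : Path a b) (q : Path b c) {N : Set C(I, X)}
    (hN : N ∈ 𝓝 (p.trans q : C(I, X))) :
    ∃ B ∈ 𝓝 (p : C(I, X)), ∃ B' ∈ 𝓝 (q : C(I, X)), ∀ {a' b' c' : X} (p' : Path a' b')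
      (q' : Path b' c'), (p' : C(I, X)) ∈ B → (q' : C(I, X)) ∈ B' →
        (p'.trans q' : C(I, X)) ∈ N := by
  -- On the space of composable pairs, concatenation is a continuous map into `C(I, X)`, obtained by
  -- currying.
  let Z : Set (C(I, X) × C(I, X)) := {z | z.1 1 = z.2 0}
  let γ₁ : ∀ z : Z, Path (z.1.1 0) (z.1.1 1) := fun z => ⟨z.1.1, rfl, rfl⟩
  let γ₂ : ∀ z : Z, Path (z.1.1 1) (z.1.2 1) := fun z => ⟨z.1.2, z.2.symm, rfl⟩
  have h₁ : Continuous ↿γ₁ := by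
    change Continuous fun z : Z × I => (z.1 : C(I, X) × C(I, X)).1 z.2
    fun_prop
  have h₂ : Continuous ↿γ₂ := by
    change Continuous fun z : Z × I => (z.1 : C(I, X) × C(I, X)).2 z.2
    fun_prop
  have h := Path.trans_continuous_family γ₁ h₁ γ₂ h₂
  let cat : C(Z, C(I, X)) := ContinuousMap.curry ⟨_, h⟩
  have hcat : ∀ {a' b' c' : X} (p' : Path a' b') (q' : Path b' c')
      (e : (p' : C(I, X)) 1 = (q' : C(I, X)) 0),
      cat ⟨((p' : C(I, X)), (q' : C(I, X))), e⟩ = (p'.trans q' : C(I, X)) := by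
    intro a' b' c' p' q' e
    ext t
    have hp : (γ₁ ⟨((p' : C(I, X)), (q' : C(I, X))), e⟩ : I → X) = p' := rfl
    have hq : (γ₂ ⟨((p' : C(I, X)), (q' : C(I, X))), e⟩ : I → X) = q' := rfl
    change ((γ₁ ⟨((p' : C(I, X)), (q' : C(I, X))), e⟩).trans (γ₂ ⟨_, e⟩)) t = (p'.trans q') t
    rw [Path.trans_apply, Path.trans_apply, hp, hq]
  have e0 : ∀ {a' b' c' : X} (p' : Path a' b') (q' : Path b' c'),
      (p' : C(I, X)) 1 = (q' : C(I, X)) 0 := fun p' q' => p'.target.trans q'.source.symm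
  have hc := cat.continuous.continuousAt (x := ⟨((p : C(I, X)), (q : C(I, X))), e0 p q⟩)
  rw [ContinuousAt, hcat] at hc
  have hmem := hc hN
  rw [Filter.mem_map, nhds_subtype, Filter.mem_comap] at hmem
  obtain ⟨M, hM, hMN⟩ := hmem
  obtain ⟨B, hB, B', hB', hBM⟩ := mem_nhds_prod_iff.1 hM
  refine ⟨B, hB, B', hB', fun p' q' hp' hq' => ?_⟩
  rw [← hcat p' q' (e0 p' q')]
  exact hMN (hBM ⟨hp', hq'⟩)

theorem eventually_symm_mem {a b : X} (p : Path a b) {N : Set C(I, X)}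
    (hN : N ∈ 𝓝 (p.symm : C(I, X))) :
    ∃ B ∈ 𝓝 (p : C(I, X)), ∀ {a' b' : X} (p' : Path a' b'), (p' : C(I, X)) ∈ B →
      (p'.symm : C(I, X)) ∈ N :=
  ⟨_, (ContinuousMap.continuous_precomp (⟨unitInterval.symm, by fun_prop⟩ : C(I, I))).continuousAt
    hN, fun _ h => h⟩

theorem eventually_subpath_mem {a b : X} (p : Path a b) (s t : I) {N : Set C(I, X)}
    (hN : N ∈ 𝓝 (p.subpath s t : C(I, X))) :
    ∃ A ∈ 𝓝 p, ∀ p' ∈ A, (p'.subpath s t : C(I, X)) ∈ N :=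
  ⟨_, ((ContinuousMap.continuous_precomp (⟨Set.Icc.convexComb s t, by fun_prop⟩ : C(I, I))).comp
    continuous_induced_dom).continuousAt hN, fun _ h => h⟩

variable [TopologicalSpace H] [IsTopologicalGroup H]

/-- A homomorphism on the fundamental group is continuous on loops if it is so near loops inside
the members of an open cover, provided that the pairwise intersections contain paths from the
basepoint whose endpoint can be moved. -/
theorem continuous_hom_of_open_cover {ι : Type w} {U : ι → Set X} (hU : ∀ i, IsOpen (U i))
    (hcov : ∀ x, ∃ i, x ∈ U i) {x₀ : X} (hx : ∀ i, x₀ ∈ U i)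
    (hwep : ∀ i j, i ≠ j → ∀ y ∈ U i ∩ U j, ∃ δ : Path x₀ y, (∀ t, δ t ∈ U i ∩ U j) ∧
      ∀ B ∈ 𝓝 (δ : C(I, X)), ∃ V ∈ 𝓝 y, ∀ y' ∈ V, ∃ δ' : Path x₀ y', (δ' : C(I, X)) ∈ B)
    {F : QTopPi1 X x₀ →* H}
    (hF : ∀ i (p : Path x₀ x₀), (∀ t, p t ∈ U i) →
      ContinuousAt (fun q : Path x₀ x₀ => F (QTopPi1.mk q)) p) :
    Continuous F := by
  have hF' : ∀ i (p : Path x₀ x₀), (∀ t, p t ∈ U i) → ∀ W ∈ 𝓝 (F (QTopPi1.mk p)),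
      ∃ N ∈ 𝓝 (p : C(I, X)), ∀ q : Path x₀ x₀, (q : C(I, X)) ∈ N → F (QTopPi1.mk q) ∈ W := by
    intro i p hp W hW
    have h := hF i p hp hW
    rw [Filter.mem_map, nhds_induced, Filter.mem_comap] at h
    obtain ⟨N, hN, hNW⟩ := h
    exact ⟨N, hN, fun q hq => hNW hq⟩
  refine continuous_coinduced_dom.2 (continuous_iff_continuousAt.2 fun α => ?_)
  obtain ⟨i, hi⟩ := hcov x₀
  have key := path_cover_induction hU hcov (α : C(I, X))
    -- The end of the return path moves with `β`, so nearness of `γ` to `γ₀` is measured in `C(I,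
    -- X)` rather than in a space of paths with fixed ends.
    (P := fun i t => ∀ γ₀ : Path x₀ (α t), (∀ s, γ₀ s ∈ U i) →
      ∀ W ∈ 𝓝 (F (QTopPi1.mk (truncatedLoop α α.source.symm t γ₀))),
      ∃ A ∈ 𝓝 α, ∃ B ∈ 𝓝 (γ₀ : C(I, X)), ∀ β ∈ A, ∀ γ : Path x₀ (β t), (γ : C(I, X)) ∈ B →
        F (QTopPi1.mk (truncatedLoop β β.source.symm t γ)) ∈ W)
    (fun i γ₀ hγ₀ W hW => by
      rw [mk_truncatedLoop_zero] at hW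
      obtain ⟨N, hN, hNW⟩ := hF' i _ (fun s => hγ₀ _) W hW
      obtain ⟨B, hB, hBN⟩ := eventually_symm_mem γ₀ hN
      refine ⟨Set.univ, Filter.univ_mem, B, hB, fun β _ γ hγ => ?_⟩
      rw [mk_truncatedLoop_zero]
      exact hNW _ (hBN γ hγ))
    (fun i s t hst hα hP γ₀ hγ₀ W hW => by
      rw [← mk_truncatedLoop_trans_subpath α _ s t γ₀] at hW
      obtain ⟨A, hA, B, hB, hAB⟩ := hP _ (fun r => by
        have : (γ₀.trans (α.subpath t s)) r ∈ Set.range (γ₀.trans (α.subpath t s)) := ⟨r, rfl⟩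
        rw [Path.trans_range, Path.range_subpath_of_ge _ _ _ hst] at this
        rcases this with ⟨r, hr⟩ | ⟨r, hr, hr'⟩
        · exact hr ▸ hγ₀ r
        · exact hr' ▸ hα r hr) W hW
      obtain ⟨B₁, hB₁, B₂, hB₂, hcat⟩ := eventually_trans_mem γ₀ (α.subpath t s) hB
      obtain ⟨A', hA', hsub⟩ := eventually_subpath_mem α t s hB₂
      refine ⟨A ∩ A', Filter.inter_mem hA hA', B₁, hB₁, fun β hβ γ hγ => ?_⟩
      rw [← mk_truncatedLoop_trans_subpath β _ s t γ]
      exact hAB β hβ.1 _ (hcat γ _ hγ (hsub β hβ.2)))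
    (fun i j t hi hj hP γ₀ hγ₀ W hW => by
      by_cases hij : i = j
      · subst hij
        exact hP γ₀ hγ₀ W hW
      obtain ⟨δ, hδ, hδV⟩ := hwep i j hij _ ⟨hi, hj⟩
      rw [mk_truncatedLoop_eq_mul α _ t γ₀ δ, map_mul] at hW
      have hm := (continuous_mul (M := H)).continuousAt
        (x := (F (QTopPi1.mk (δ.trans γ₀.symm)),
          F (QTopPi1.mk (truncatedLoop α α.source.symm t δ)))) hW
      obtain ⟨W₁, hW₁, W₂, hW₂, hWW⟩ := mem_nhds_prod_iff.1 hm
      obtain ⟨A, hA, B, hB, hAB⟩ := hP δ (fun s => (hδ s).1) W₂ hW₂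
      obtain ⟨N, hN, hNW⟩ := hF' j (δ.trans γ₀.symm) (fun r => by
        have : (δ.trans γ₀.symm) r ∈ Set.range (δ.trans γ₀.symm) := ⟨r, rfl⟩
        rw [Path.trans_range, Path.symm_range] at this
        rcases this with ⟨r, hr⟩ | ⟨r, hr⟩
        · exact hr ▸ (hδ r).2
        · exact hr ▸ hγ₀ r) W₁ hW₁
      obtain ⟨B₁, hB₁, B₂, hB₂, hcat⟩ := eventually_trans_mem δ γ₀.symm hN
      obtain ⟨B₃, hB₃, hsymm⟩ := eventually_symm_mem γ₀ hB₂
      -- One path `δ'` ending at `β t` must be near `δ` for both factors.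
      obtain ⟨V, hV, hVδ⟩ := hδV _ (Filter.inter_mem hB hB₁)
      have hev : Continuous fun β : Path x₀ x₀ => β t := by fun_prop
      refine ⟨A ∩ (fun β : Path x₀ x₀ => β t) ⁻¹' V,
        Filter.inter_mem hA (hev.continuousAt hV), B₃, hB₃, fun β hβ γ hγ => ?_⟩
      obtain ⟨δ', hδ', hδ₁⟩ := hVδ _ hβ.2
      rw [mk_truncatedLoop_eq_mul β _ t γ δ', map_mul]
      exact hWW (Set.mk_mem_prod (hNW _ (hcat δ' _ hδ₁ (hsymm γ hγ))) (hAB β hβ.1 δ' hδ')))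
    i (by simpa using hx i) ((Path.refl x₀).cast rfl α.target) (fun _ => hx i)
  intro W hW
  rw [mk_truncatedLoop_one α _ _ rfl rfl] at key
  obtain ⟨A, hA, B, hB, hAB⟩ := key W hW
  refine Filter.mem_map.2 ?_
  refine Filter.mem_of_superset hA fun β hβ => ?_
  -- At time `1` the endpoint no longer moves: the constant return path is the same element of `C(I,
  -- X)` for `α` and `β`.
  have := hAB β hβ ((Path.refl x₀).cast rfl β.target) (mem_of_mem_nhds hB)
  rw [mk_truncatedLoop_one β _ _ rfl rfl] at this
  exact this

end Pieces

/-! ### Universal properties of free topological products -/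

namespace FreeTopProd

variable (G₁ : Type u) (G₂ : Type v) [Group G₁] [Group G₂]

theorem k_of (g : G₁ ⊕ G₂) : k G₁ G₂ (FreeTopGroup.of g) = Sum.elim (inl G₁ G₂) (inr G₁ G₂) g :=
  FreeTopGroup.lift_of _ g

theorem k_surjective : Function.Surjective (k G₁ G₂) := by
  rw [← MonoidHom.range_eq_top, eq_top_iff]
  have h : (⊤ : Subgroup (FreeTopProd G₁ G₂)) = (inl G₁ G₂).range ⊔ (inr G₁ G₂).range :=
    (Monoid.Coprod.range_inl_sup_range_inr (G := G₁) (H := G₂)).symm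
  rw [h, sup_le_iff]
  constructor
  · rintro _ ⟨g, rfl⟩
    exact ⟨_, k_of G₁ G₂ (Sum.inl g)⟩
  · rintro _ ⟨g, rfl⟩
    exact ⟨_, k_of G₁ G₂ (Sum.inr g)⟩

section Lift

variable {G₁ G₂} {H : Type w} [Group H]

/-- The homomorphism on the free product induced by homomorphisms on the factors. -/
def lift (f₁ : G₁ →* H) (f₂ : G₂ →* H) : FreeTopProd G₁ G₂ →* H := Monoid.Coprod.lift f₁ f₂

theorem lift_inl (f₁ : G₁ →* H) (f₂ : G₂ →* H) (g : G₁) : lift f₁ f₂ (inl G₁ G₂ g) = f₁ g :=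
  Monoid.Coprod.lift_apply_inl f₁ f₂ g

theorem lift_inr (f₁ : G₁ →* H) (f₂ : G₂ →* H) (g : G₂) : lift f₁ f₂ (inr G₁ G₂ g) = f₂ g :=
  Monoid.Coprod.lift_apply_inr f₁ f₂ g

end Lift

variable [TopologicalSpace G₁] [TopologicalSpace G₂]

instance : IsTopologicalGroup (FreeTopProd G₁ G₂) :=
  isTopologicalGroup_coinduced (k G₁ G₂) (k_surjective G₁ G₂)

theorem continuous_k : Continuous (k G₁ G₂) := continuous_coinduced_rng

theorem continuous_inl : Continuous (inl G₁ G₂) := by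
  have h : (inl G₁ G₂ : G₁ → FreeTopProd G₁ G₂) = fun g => k G₁ G₂ (FreeTopGroup.of (Sum.inl g)) :=
    funext fun g => (k_of G₁ G₂ (Sum.inl g)).symm
  rw [h]
  exact (continuous_k G₁ G₂).comp (FreeTopGroup.continuous_of.comp _root_.continuous_inl)

theorem continuous_inr : Continuous (inr G₁ G₂) := by
  have h : (inr G₁ G₂ : G₂ → FreeTopProd G₁ G₂) = fun g => k G₁ G₂ (FreeTopGroup.of (Sum.inr g)) :=
    funext fun g => (k_of G₁ G₂ (Sum.inr g)).symm
  rw [h]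
  exact (continuous_k G₁ G₂).comp (FreeTopGroup.continuous_of.comp _root_.continuous_inr)

variable {G₁ G₂} {H : Type w} [Group H]

/-- The topology is coinduced from the free topological group, where continuity is tested on the
generators `G₁ ⊕ G₂`. -/
theorem continuous_lift [TopologicalSpace H] [IsTopologicalGroup H] {f₁ : G₁ →* H} {f₂ : G₂ →* H}
    (h₁ : Continuous f₁) (h₂ : Continuous f₂) : Continuous (lift f₁ f₂) := by
  refine continuous_coinduced_dom.2 ?_
  have h : (lift f₁ f₂).comp (k G₁ G₂) = FreeTopGroup.lift (Sum.elim f₁ f₂) :=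
    FreeTopGroup.hom_ext fun g => by
      rw [FreeTopGroup.lift_of, MonoidHom.comp_apply, k_of]
      rcases g with g | g
      · exact lift_inl f₁ f₂ g
      · exact lift_inr f₁ f₂ g
  have h' : (lift f₁ f₂ ∘ k G₁ G₂ : FreeTopGroup (G₁ ⊕ G₂) → H) =
      FreeTopGroup.lift (Sum.elim f₁ f₂) := by
    rw [← h]; rfl
  rw [h']
  exact FreeTopGroup.continuous_lift (h₁.sumElim h₂)

end FreeTopProd

namespace AmalgTopProd

variable {K : Type w} {G₁ : Type u} {G₂ : Type v} [Group K] [Group G₁] [Group G₂]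
  {φ₁ : K →* G₁} {φ₂ : K →* G₂}

theorem inl_comp_eq (h : K) : inl φ₁ φ₂ (φ₁ h) = inr φ₁ φ₂ (φ₂ h) := by
  rw [inl, inr, MonoidHom.comp_apply, MonoidHom.comp_apply, ← mul_inv_eq_one, ← map_inv, ← map_mul]
  exact (QuotientGroup.eq_one_iff _).2 (Subgroup.subset_normalClosure ⟨h, rfl⟩)

/-- The homomorphism on the amalgamated product induced by compatible homomorphisms. -/
def lift {H : Type*} [Group H] (f₁ : G₁ →* H) (f₂ : G₂ →* H) (h : ∀ x, f₁ (φ₁ x) = f₂ (φ₂ x)) :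
    AmalgTopProd φ₁ φ₂ →* H :=
  QuotientGroup.lift (amalgamRel φ₁ φ₂) (FreeTopProd.lift f₁ f₂)
    (Subgroup.normalClosure_le_normal (by
      rintro _ ⟨x, rfl⟩
      change FreeTopProd.lift f₁ f₂ _ = 1
      rw [map_mul, map_inv, FreeTopProd.lift_inl, FreeTopProd.lift_inr, h, mul_inv_cancel]))

theorem lift_inl {H : Type*} [Group H] (f₁ : G₁ →* H) (f₂ : G₂ →* H)
    (h : ∀ x, f₁ (φ₁ x) = f₂ (φ₂ x)) (g : G₁) : lift f₁ f₂ h (inl φ₁ φ₂ g) = f₁ g :=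
  FreeTopProd.lift_inl f₁ f₂ g

theorem lift_inr {H : Type*} [Group H] (f₁ : G₁ →* H) (f₂ : G₂ →* H)
    (h : ∀ x, f₁ (φ₁ x) = f₂ (φ₂ x)) (g : G₂) : lift f₁ f₂ h (inr φ₁ φ₂ g) = f₂ g :=
  FreeTopProd.lift_inr f₁ f₂ g

theorem hom_ext {H : Type*} [Group H] {f g : AmalgTopProd φ₁ φ₂ →* H}
    (h₁ : ∀ x, f (inl φ₁ φ₂ x) = g (inl φ₁ φ₂ x)) (h₂ : ∀ x, f (inr φ₁ φ₂ x) = g (inr φ₁ φ₂ x)) :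
    f = g :=
  QuotientGroup.monoidHom_ext _
    (Monoid.Coprod.hom_ext (MonoidHom.ext h₁) (MonoidHom.ext h₂))

variable [TopologicalSpace G₁] [TopologicalSpace G₂]

theorem continuous_inl : Continuous (inl φ₁ φ₂) :=
  QuotientGroup.continuous_mk.comp (FreeTopProd.continuous_inl G₁ G₂)

theorem continuous_inr : Continuous (inr φ₁ φ₂) :=
  QuotientGroup.continuous_mk.comp (FreeTopProd.continuous_inr G₁ G₂)

theorem continuous_lift {H : Type*} [Group H] [TopologicalSpace H] [IsTopologicalGroup H]
    {f₁ : G₁ →* H} {f₂ : G₂ →* H} (h : ∀ x, f₁ (φ₁ x) = f₂ (φ₂ x)) (h₁ : Continuous f₁)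
    (h₂ : Continuous f₂) : Continuous (lift f₁ f₂ h) :=
  (FreeTopProd.continuous_lift h₁ h₂).quotient_lift _

end AmalgTopProd

/-! ### The topological van Kampen theorem -/

/-- The image consists of the paths sending the compact interval into the open set `U`, a subbasic
open condition. Continuity on paths of `U` thus gives continuity at these paths within the paths of
`X`. -/
theorem isOpenEmbedding_path_map_subtype_val {X : Type u} [TopologicalSpace X] {U : Set X}
    (hU : IsOpen U) {x y : U} :
    IsOpenEmbedding fun p : Path x y => p.map continuous_subtype_val := by
  refine ⟨⟨?_, fun p q h => ?_⟩, ?_⟩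
  · have h : IsInducing fun p : Path x y => (p : C(I, U)) := ⟨rfl⟩
    have h' : IsInducing fun p : Path (x : X) y => (p : C(I, X)) := ⟨rfl⟩
    rw [← h'.of_comp_iff]
    exact (ContinuousMap.isInducing_postcomp (⟨Subtype.val, continuous_subtype_val⟩ : C(U, X))
      IsInducing.subtypeVal).comp h
  · ext t
    exact congrArg (fun r : Path (x : X) y => r t) h
  · have : Set.range (fun p : Path x y => p.map continuous_subtype_val) =
        (fun p : Path (x : X) y => (p : C(I, X))) ⁻¹' {f | Set.MapsTo f Set.univ U} := by
      ext p
      constructor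
      · rintro ⟨q, rfl⟩ t _
        exact (q t).2
      · intro hp
        exact ⟨⟨pathRestrict (p : C(I, X)) fun t => hp (Set.mem_univ t),
          Subtype.ext p.source, Subtype.ext p.target⟩, rfl⟩
    rw [this]
    exact (ContinuousMap.isOpen_setOfPred_mapsTo isCompact_univ hU).preimage continuous_induced_dom

theorem continuousAt_path_map_subtype_val {X : Type u} [TopologicalSpace X] {U : Set X}
    (hU : IsOpen U) {x y : U} {Z : Type v} [TopologicalSpace Z] {f : Path (x : X) y → Z}
    (hf : Continuous fun p : Path x y => f (p.map continuous_subtype_val)) (q : Path x y) :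
    ContinuousAt f (q.map continuous_subtype_val) :=
  (isOpenEmbedding_path_map_subtype_val hU).continuousAt_iff.1 hf.continuousAt

/-- In a wep-connected open subspace every point is the end of a path whose endpoint can be moved. -/
theorem WepConnected.exists_path {X : Type u} [TopologicalSpace X] {U : Set X} (hU : IsOpen U)
    (h : WepConnected U) {x y : X} (hx : x ∈ U) (hy : y ∈ U) :
    ∃ δ : Path x y, (∀ t, δ t ∈ U) ∧ ∀ B ∈ 𝓝 (δ : C(I, X)), ∃ V ∈ 𝓝 y, ∀ y' ∈ V,
      ∃ δ' : Path x y', (δ' : C(I, X)) ∈ B := by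
  obtain ⟨p, hp, hp0, hp1⟩ := h ⟨x, hx⟩ ⟨y, hy⟩
  let j : C(U, X) := ⟨Subtype.val, continuous_subtype_val⟩
  refine ⟨⟨j.comp p, congrArg Subtype.val hp0, congrArg Subtype.val hp1⟩, fun t => (p t).2,
    fun B hB => ?_⟩
  have hc := (ContinuousMap.continuous_postcomp (X := I) j).continuousAt (x := p) hB
  obtain ⟨𝒰, h𝒰, h𝒰o, hp𝒰⟩ := mem_nhds_iff.1 hc
  obtain ⟨V₀, V₁, -, hV₁, h0, h1, hV⟩ := hp 𝒰 h𝒰o hp𝒰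
  refine ⟨Subtype.val '' V₁, (hU.isOpenMap_subtype_val _ hV₁).mem_nhds ⟨p 1, h1, by rw [hp1]⟩, ?_⟩
  rintro _ ⟨b, hb, rfl⟩
  -- The start stays at `p 0`; only the terminal freedom is needed.
  obtain ⟨q, hq, hq0, hq1⟩ := hV _ h0 b hb
  exact ⟨⟨j.comp q, congrArg Subtype.val (hq0.trans hp0), congrArg Subtype.val hq1⟩, h𝒰 hq⟩

/-- The universal property of `π₁^τ(X, x₀)` as a pushout. -/
theorem TauPi1.existsUnique_hom {X : Type u} [TopologicalSpace X] {x₀ : X} {U₁ U₂ : Set X}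
    (hU₁ : IsOpen U₁) (hU₂ : IsOpen U₂) (hcover : U₁ ∪ U₂ = Set.univ) (hx : x₀ ∈ U₁ ∩ U₂)
    (hpc₁ : IsPathConnected U₁) (hpc₂ : IsPathConnected U₂) (hpc : IsPathConnected (U₁ ∩ U₂))
    (hwep : WepConnected (U₁ ∩ U₂ : Set X)) {H : Type v} [Group H] [TopologicalSpace H]
    [IsTopologicalGroup H] (f₁ : TauPi1 U₁ ⟨x₀, hx.1⟩ →ₜ* H) (f₂ : TauPi1 U₂ ⟨x₀, hx.2⟩ →ₜ* H)
    (hf : ∀ g, f₁ (TauPi1.incl (Set.inter_subset_left : U₁ ∩ U₂ ⊆ U₁) hx g) =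
      f₂ (TauPi1.incl (Set.inter_subset_right : U₁ ∩ U₂ ⊆ U₂) hx g)) :
    ∃! F : TauPi1 X x₀ →ₜ* H, (∀ g, F (TauPi1.inclTop U₁ hx.1 g) = f₁ g) ∧
      ∀ g, F (TauPi1.inclTop U₂ hx.2 g) = f₂ g := by
  let g₁ : QTopPi1 U₁ ⟨x₀, hx.1⟩ →* H := f₁.toMonoidHom.comp (Tau.r _).toMonoidHom
  let g₂ : QTopPi1 U₂ ⟨x₀, hx.2⟩ →* H := f₂.toMonoidHom.comp (Tau.r _).toMonoidHom
  have hg₁ : Continuous g₁ := f₁.continuous_toFun.comp (Tau.continuous_r _)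
  have hg₂ : Continuous g₂ := f₂.continuous_toFun.comp (Tau.continuous_r _)
  obtain ⟨F, hF₁, hF₂⟩ := exists_hom_of_open_cover hU₁ hU₂ hcover hx hpc₁ hpc₂ hpc g₁ g₂
    (fun p => by
      have h := hf (Tau.r _ (QTopPi1.mk p))
      have e₁ := QTopPi1.map_mk (⟨Set.inclusion Set.inter_subset_left,
        continuous_inclusion Set.inter_subset_left⟩ : C((U₁ ∩ U₂ : Set X), U₁)) rfl p
      have e₂ := QTopPi1.map_mk (⟨Set.inclusion Set.inter_subset_right,
        continuous_inclusion Set.inter_subset_right⟩ : C((U₁ ∩ U₂ : Set X), U₂)) rfl p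
      exact (congrArg g₁ e₁).symm.trans (h.trans (congrArg g₂ e₂)))
  let U : Bool → Set X := fun b => cond b U₁ U₂
  have hU : ∀ b, IsOpen (U b) := by rintro (_ | _) <;> assumption
  have hxU : ∀ b, x₀ ∈ U b := by
    rintro (_ | _)
    exacts [hx.2, hx.1]
  have hcov : ∀ x, ∃ b, x ∈ U b := fun x => by
    rcases (hcover ▸ Set.mem_univ x : x ∈ U₁ ∪ U₂) with h | h
    · exact ⟨true, h⟩
    · exact ⟨false, h⟩
  have hlift : ∀ {V : Set X} (hV : x₀ ∈ V) (p : Path x₀ x₀), (∀ t, p t ∈ V) →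
      ∃ q : Path (⟨x₀, hV⟩ : V) ⟨x₀, hV⟩, q.map continuous_subtype_val = p := fun hV p hp =>
    ⟨⟨pathRestrict (p : C(I, X)) hp, Subtype.ext p.source, Subtype.ext p.target⟩, rfl⟩
  have hcont : Continuous F := by
    refine continuous_hom_of_open_cover hU hcov hxU ?_ ?_
    · intro i j hij y hy
      have hU12 := hU₁.inter hU₂
      rcases i with _ | _ <;> rcases j with _ | _
      · exact absurd rfl hij
      · obtain ⟨δ, hδ, h⟩ := hwep.exists_path hU12 hx hy.symm
        exact ⟨δ, fun t => (hδ t).symm, h⟩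
      · exact hwep.exists_path hU12 hx hy
      · exact absurd rfl hij
    · rintro (_ | _) p hp
      · obtain ⟨q, rfl⟩ := hlift hx.2 p hp
        refine continuousAt_path_map_subtype_val hU₂ (x := ⟨x₀, hx.2⟩) (y := ⟨x₀, hx.2⟩) ?_ q
        exact (hg₂.comp continuous_coinduced_rng).congr fun p => (hF₂ p).symm
      · obtain ⟨q, rfl⟩ := hlift hx.1 p hp
        refine continuousAt_path_map_subtype_val hU₁ (x := ⟨x₀, hx.1⟩) (y := ⟨x₀, hx.1⟩) ?_ q
        exact (hg₁.comp continuous_coinduced_rng).congr fun p => (hF₁ p).symm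
  have hmap : ∀ {V : Set X} (hV : x₀ ∈ V) (p : Path (⟨x₀, hV⟩ : V) ⟨x₀, hV⟩),
      TauPi1.inclTop V hV (Tau.r _ (QTopPi1.mk p)) =
        Tau.r _ (QTopPi1.mk (p.map continuous_subtype_val)) := fun hV p =>
    QTopPi1.map_mk (⟨Subtype.val, continuous_subtype_val⟩ : C(_, X)) rfl p
  let F' : TauPi1 X x₀ →* H := F.comp (Tau.r _).symm.toMonoidHom
  refine ⟨⟨F', Tau.continuous_of_comp_r hcont⟩, ⟨fun g => ?_, fun g => ?_⟩, ?_⟩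
  · obtain ⟨p, rfl⟩ := QTopPi1.mk_surjective g
    exact (congrArg F' (hmap hx.1 p)).trans (hF₁ p)
  · obtain ⟨p, rfl⟩ := QTopPi1.mk_surjective g
    exact (congrArg F' (hmap hx.2 p)).trans (hF₂ p)
  · rintro E ⟨hE₁, hE₂⟩
    let E' : QTopPi1 X x₀ →* H := E.toMonoidHom.comp (Tau.r _).toMonoidHom
    -- Uniqueness is purely algebraic: path connectedness suffices here.
    have key : E' = F := by
      refine hom_eq_of_open_cover hU hcov hxU ?_ ?_
      · intro i j y hy
        have hj : ∀ {V : Set X}, IsPathConnected V → x₀ ∈ V → y ∈ V →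
            ∃ δ : Path x₀ y, ∀ t, δ t ∈ V := fun hV hx hy => hV.joinedIn _ hx _ hy
        rcases i with _ | _ <;> rcases j with _ | _
        · rw [Set.inter_self]; exact hj hpc₂ hx.2 hy.1
        · rw [Set.inter_comm]; exact hj hpc hx hy.symm
        · exact hj hpc hx hy
        · rw [Set.inter_self]; exact hj hpc₁ hx.1 hy.1
      · rintro (_ | _) p hp
        · obtain ⟨q, rfl⟩ := hlift hx.2 p hp
          rw [hF₂]
          exact (congrArg E (hmap hx.2 q)).symm.trans (hE₂ _)
        · obtain ⟨q, rfl⟩ := hlift hx.1 p hp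
          rw [hF₁]
          exact (congrArg E (hmap hx.1 q)).symm.trans (hE₁ _)
    refine ContinuousMonoidHom.ext fun g => ?_
    exact DFunLike.congr_fun key g

theorem TauPi1.inclTop_incl {X : Type u} [TopologicalSpace X] {U₁ U₂ : Set X} {x₀ : X}
    (hx : x₀ ∈ U₁ ∩ U₂) (g : TauPi1 (U₁ ∩ U₂ : Set X) ⟨x₀, hx⟩) :
    TauPi1.inclTop U₁ hx.1 (TauPi1.incl (Set.inter_subset_left : U₁ ∩ U₂ ⊆ U₁) hx g) =
      TauPi1.inclTop U₂ hx.2 (TauPi1.incl (Set.inter_subset_right : U₁ ∩ U₂ ⊆ U₂) hx g) := by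
  obtain ⟨p, rfl⟩ := QTopPi1.mk_surjective g
  have e : ∀ {V : Set X} (hV : U₁ ∩ U₂ ⊆ V),
      QTopPi1.map (⟨Subtype.val, continuous_subtype_val⟩ : C(V, X)) rfl
        (QTopPi1.map (⟨Set.inclusion hV, continuous_inclusion hV⟩ : C((U₁ ∩ U₂ : Set X), V)) rfl
          (QTopPi1.mk p)) = QTopPi1.mk (p.map continuous_subtype_val) := by
    intro V hV
    rw [QTopPi1.map_mk]
    exact QTopPi1.map_mk _ rfl _
  exact (e Set.inter_subset_left).trans (e Set.inter_subset_right).symm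

theorem TopGrp.hom_congr {A B : TopGrp.{u}} {f g : A ⟶ B} (h : f = g) (x : A.carrier) :
    DFunLike.coe (F := A.carrier →ₜ* B.carrier) f x =
      DFunLike.coe (F := A.carrier →ₜ* B.carrier) g x := by
  rw [h]

/-- The topological van Kampen theorem: the square of inclusion-induced homomorphisms is a pushout
in the category of topological groups, and the canonical map from the free topological product with
amalgamation to `π₁^τ(X, x₀)` is an isomorphism of topological groups. -/
theorem mainTheorem3 {X : Type u} [TopologicalSpace X] (x₀ : X) (U₁ U₂ : Set X)
    (hU₁ : IsOpen U₁) (hU₂ : IsOpen U₂) (hcover : U₁ ∪ U₂ = Set.univ)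
    (hx : x₀ ∈ U₁ ∩ U₂)
    (hpc₁ : IsPathConnected U₁) (hpc₂ : IsPathConnected U₂) (hpc : IsPathConnected (U₁ ∩ U₂))
    (hwep : WepConnected (U₁ ∩ U₂ : Set X)) :
    IsPushout
        (TopGrp.ofHom (TauPi1.incl (Set.inter_subset_left : U₁ ∩ U₂ ⊆ U₁) hx))
        (TopGrp.ofHom (TauPi1.incl (Set.inter_subset_right : U₁ ∩ U₂ ⊆ U₂) hx))
        (TopGrp.ofHom (TauPi1.inclTop U₁ hx.1))
        (TopGrp.ofHom (TauPi1.inclTop U₂ hx.2)) ∧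
      ∃ e : AmalgTopProd
          (TauPi1.incl (Set.inter_subset_left : U₁ ∩ U₂ ⊆ U₁) hx).toMonoidHom
          (TauPi1.incl (Set.inter_subset_right : U₁ ∩ U₂ ⊆ U₂) hx).toMonoidHom ≃ₜ* TauPi1 X x₀,
        (∀ g : TauPi1 U₁ ⟨x₀, hx.1⟩,
          e (AmalgTopProd.inl _ _ g) = TauPi1.inclTop U₁ hx.1 g) ∧
        (∀ g : TauPi1 U₂ ⟨x₀, hx.2⟩,
          e (AmalgTopProd.inr _ _ g) = TauPi1.inclTop U₂ hx.2 g) := by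
  have univ := fun {H : Type u} [Group H] [TopologicalSpace H] [IsTopologicalGroup H] =>
    TauPi1.existsUnique_hom hU₁ hU₂ hcover hx hpc₁ hpc₂ hpc hwep (H := H)
  refine ⟨IsPushout.mk ⟨?_⟩ ⟨Limits.PushoutCocone.IsColimit.mk _
    (fun s => (univ s.inl s.inr fun g => TopGrp.hom_congr s.condition g).choose)
    (fun s => ContinuousMonoidHom.ext
      (univ s.inl s.inr fun g => TopGrp.hom_congr s.condition g).choose_spec.1.1)
    (fun s => ContinuousMonoidHom.ext
      (univ s.inl s.inr fun g => TopGrp.hom_congr s.condition g).choose_spec.1.2)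
    (fun s m h₁ h₂ => (univ s.inl s.inr fun g => TopGrp.hom_congr s.condition g).choose_spec.2 m
      ⟨fun g => TopGrp.hom_congr h₁ g, fun g => TopGrp.hom_congr h₂ g⟩)⟩, ?_⟩
  · exact ContinuousMonoidHom.ext (TauPi1.inclTop_incl hx)
  · let φ₁ := (TauPi1.incl (Set.inter_subset_left : U₁ ∩ U₂ ⊆ U₁) hx).toMonoidHom
    let φ₂ := (TauPi1.incl (Set.inter_subset_right : U₁ ∩ U₂ ⊆ U₂) hx).toMonoidHom
    let l₁ := TauPi1.inclTop U₁ hx.1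
    let l₂ := TauPi1.inclTop U₂ hx.2
    let e : AmalgTopProd φ₁ φ₂ →* TauPi1 X x₀ :=
      AmalgTopProd.lift l₁.toMonoidHom l₂.toMonoidHom (TauPi1.inclTop_incl hx)
    have he : Continuous e :=
      AmalgTopProd.continuous_lift _ l₁.continuous_toFun l₂.continuous_toFun
    have he₁ : ∀ g, e (AmalgTopProd.inl φ₁ φ₂ g) = l₁ g := AmalgTopProd.lift_inl _ _ _
    have he₂ : ∀ g, e (AmalgTopProd.inr φ₁ φ₂ g) = l₂ g := AmalgTopProd.lift_inr _ _ _
    -- The inverse of `e` comes with its continuity from the universal property of `TauPi1 X x₀`;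
    -- the two composites are identities by uniqueness on either side.
    obtain ⟨F, ⟨hF₁, hF₂⟩, -⟩ := univ (H := AmalgTopProd φ₁ φ₂)
      ⟨AmalgTopProd.inl φ₁ φ₂, AmalgTopProd.continuous_inl⟩
      ⟨AmalgTopProd.inr φ₁ φ₂, AmalgTopProd.continuous_inr⟩ AmalgTopProd.inl_comp_eq
    have hFe : F.toMonoidHom.comp e = MonoidHom.id _ := AmalgTopProd.hom_ext
      (fun g => (congrArg F (he₁ g)).trans (hF₁ g)) (fun g => (congrArg F (he₂ g)).trans (hF₂ g))
    have heF : ContinuousMonoidHom.comp ⟨e, he⟩ F = ContinuousMonoidHom.id _ :=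
      (univ l₁ l₂ (TauPi1.inclTop_incl hx)).unique
        ⟨fun g => (congrArg e (hF₁ g)).trans (he₁ g), fun g => (congrArg e (hF₂ g)).trans (he₂ g)⟩
        ⟨fun _ => rfl, fun _ => rfl⟩
    exact ⟨{ MonoidHom.toMulEquiv e F.toMonoidHom hFe
        (MonoidHom.ext fun g => DFunLike.congr_fun heF g) with
        continuous_toFun := he
        continuous_invFun := F.continuous_toFun }, he₁, he₂⟩
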